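/- Let $G=(V,E)$ be a finite undirected graph with $p=|V|$ nodes that is decomposable (that is, it is complete, or $V$ is a disjoint union $a\cup c\cup b$ with $a,b$ nonempty, $c$ complete and separating $a$ from $b$, such that the subgraphs induced by $a\cup c$ and by $c\cup b$ are decomposable). Let $C_1,\dots,C_N$ be its cliques (maximal complete subsets of $V$) in a perfect elimination order: with $H_j=C_1\cup\dots\cup C_j$, $S_j=H_{j-1}\cap C_j$ and $R_j=H_j\setminus H_{j-1}$, the triple $(H_{j-1}\setminus S_j,\,S_j,\,R_j)$ is a decomposition of the subgraph induced by $H_j$ for $j=2,\dots,N$ (that is, the three sets are disjoint with union $H_j$, $S_j$ is complete, and $S_j$ separates the other two in that subgraph). Put $c_k=|C_k|$ and $s_k=|S_k|$. Let $\mathcal K$ be the set of real symmetric positive definite $p\times p$ matrices $\mathbf K$ with $[\mathbf K]_{H_{j-1}\setminus S_j,\,R_j}=\mathbf 0$ for $j=2,\dots,N$, and let $\mathbf x[1],\dots,\mathbf x[n]$ be independent zero mean Gaussian vectors in $\mathbb R^p$ with covariance matrix $\mathbf K^{-1}$, where $\mathbf K\in\mathcal K$ is unknown. Let $\mathbf S$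 be the incomplete sample covariance matrix, which consists of the entries $(i,j)$ of $\sum_{t=1}^n \mathbf x[t]\mathbf x[t]^T$ with $i=j$ or $\{i,j\}\in E$, and let $\mathbf S_k$ and $\mathbf S_{[k]}$ be its blocks with rows and columns in $C_k$ and in $S_k$, respectively. Let $[\mathbf M]^0$ denote the $p\times p$ matrix obtained from such a block $\mathbf M$ by filling in zeros. Consider $$\hat{\mathbf K}=\sum_{k=1}^{N}\left[(n-c_k-1)\,\mathbf S_k^{-1}\right]^0-\sum_{k=2}^{N}\left[(n-s_k-1)\,\mathbf S_{[k]}^{-1}\right]^0 .$$ 1. If $n\ge\max_k c_k$, then, for every $\mathbf K\in\mathcal K$, all the inverses exist with probability one, so $\hat{\mathbf K}$ exists with probability one. 2. If $n\ge\max_k c_k+2$, then $\hat{\mathbf K}$ is the minimum variance unbiased estimator of $\mathbf K\in\mathcal K$ given $\mathbf S$: each entry of $\hat{\mathbf K}$ is integrable and $E\{\hat{\mathbf K}\}=\mathbf K$ for all $\mathbf K\in\mathcal K$; every estimator $\mathbf T=\mathbf T(\mathbf S)$ that is unbiased for all $\mathbf K\in\mathcal K$ satisfies $E\|\hat{\mathbf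 K}-E\hat{\mathbf K}\|^2\le E\|\mathbf T-E\mathbf T\|^2$ for all $\mathbf K\in\mathcal K$ (Frobenius norm; values in $[0,\infty]$); and any unbiased $\mathbf T(\mathbf S)$ with the same minimality property equals $\hat{\mathbf K}$ with probability one, for all $\mathbf K\in\mathcal K$. -/

import Mathlib

open MeasureTheory ProbabilityTheory

namespace GGM

/-! ### Decomposable graphs -/

section Graph

variable {V : Type*}

/-- In the subgraph of `G` induced by `H`, the set `c` separates `a` and `b`: every path from `a`
to `b` that stays inside `H` meets `c`. -/
def SeparatesIn (G : SimpleGraph V) (H a c b : Finset V) : Prop :=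
  ∀ u ∈ a, ∀ v ∈ b, ∀ p : G.Walk u v, (∀ w ∈ p.support, w ∈ H) → ∃ w ∈ p.support, w ∈ c

variable [DecidableEq V]

/-- `(a, c, b)` is a decomposition of the subgraph of `G` induced by `H`: the three sets are
disjoint with union `H`, `c` separates `a` from `b` in that subgraph, and `c` is complete. -/
structure IsDecomposition (G : SimpleGraph V) (H a c b : Finset V) : Prop where
  disjoint_left : Disjoint a c
  disjoint_right : Disjoint c b
  disjoint_outer : Disjoint a b
  union_eq : a ∪ c ∪ b = H
  separates : SeparatesIn G H a c b
  complete : G.IsClique (c : Set V)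

/-- The subgraph of `G` induced by a set of nodes is decomposable: it is complete, or it has a
decomposition `(a, c, b)` into two decomposable subgraphs, those induced by `a ∪ c` and `c ∪ b`. -/
inductive IsDecomposableOn (G : SimpleGraph V) : Finset V → Prop
  | complete (H : Finset V) : G.IsClique (H : Set V) → IsDecomposableOn G H
  | decompose (H a c b : Finset V) : IsDecomposition G H a c b → a.Nonempty → b.Nonempty →
      IsDecomposableOn G (a ∪ c) → IsDecomposableOn G (c ∪ b) → IsDecomposableOn G H

/-- `G` is a decomposable (chordal) graph. -/
def IsDecomposable [Fintype V] (G : SimpleGraph V) : Prop :=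
  IsDecomposableOn G Finset.univ

/-! A sequence of `m + 1` sets `C 0, …, C m`.  (Every finite graph has at least one maximal
complete subset, so no case is lost by this way of indexing.) -/

/-- The history `H_j = C_0 ∪ … ∪ C_j`. -/
def history {m : ℕ} (C : Fin (m + 1) → Finset V) (j : Fin (m + 1)) : Finset V :=
  (Finset.univ.filter fun i => i ≤ j).biUnion C

/-- The separator `H_{j-1} ∩ C_j`, for `j = 1, …, m`; here `j` is `k.succ` and `j - 1` is
`k.castSucc`. -/
def sep {m : ℕ} (C : Fin (m + 1) → Finset V) (k : Fin m) : Finset V :=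
  history C k.castSucc ∩ C k.succ

/-- The residual `H_j \ H_{j-1}`, for `j = 1, …, m`. -/
def residual {m : ℕ} (C : Fin (m + 1) → Finset V) (k : Fin m) : Finset V :=
  history C k.succ \ history C k.castSucc

/-- `C 0, …, C m` lists the cliques (maximal complete subsets) of `G`, each of them once, in a
perfect elimination order. -/
structure IsPerfectCliqueOrder (G : SimpleGraph V) {m : ℕ} (C : Fin (m + 1) → Finset V) :
    Prop where
  injective : Function.Injective C
  range_eq : ∀ A : Finset V,
    (∃ k, C k = A) ↔ Maximal (fun B : Finset V => G.IsClique (B : Set V)) A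
  decomposition : ∀ k : Fin m, IsDecomposition G (history C k.succ)
    (history C k.castSucc \ sep C k) (sep C k) (residual C k)

theorem IsPerfectCliqueOrder.isClique {G : SimpleGraph V} {m : ℕ} {C : Fin (m + 1) → Finset V}
    (hC : IsPerfectCliqueOrder G C) (k : Fin (m + 1)) : G.IsClique (C k : Set V) :=
  ((hC.range_eq (C k)).1 ⟨k, rfl⟩).prop

theorem IsPerfectCliqueOrder.isClique_sep {G : SimpleGraph V} {m : ℕ}
    {C : Fin (m + 1) → Finset V} (hC : IsPerfectCliqueOrder G C) (k : Fin m) :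
    G.IsClique (sep C k : Set V) :=
  (hC.decomposition k).complete

end Graph

noncomputable section Statistics

variable {V : Type*} [Fintype V] [DecidableEq V]

/-! ### The model -/

/-- The concentration matrices of the model: positive definite matrices whose blocks with rows
`H_{j-1} \ S_j` and columns `R_j` vanish.  (Positive definite, because a concentration matrix is
the inverse of a covariance matrix.) -/
def concentrationSet {m : ℕ} (C : Fin (m + 1) → Finset V) : Set (Matrix V V ℝ) :=
  {K | K.PosDef ∧
    ∀ k : Fin m, ∀ i ∈ history C k.castSucc \ sep C k, ∀ j ∈ residual C k, K i j = 0}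

/-- The joint law of `n` independent zero mean Gaussian vectors with concentration matrix `K`. -/
def sampleLaw (n : ℕ) (K : Matrix V V ℝ) : Measure (Fin n → EuclideanSpace ℝ V) :=
  Measure.pi fun _ => multivariateGaussian 0 K⁻¹

/-! ### The incomplete sample covariance -/

/-- Positions `(i, j)` with `i = j` or `i`, `j` adjacent, i.e. the edges of `G` under the convention
that each node is connected to itself. -/
abbrev Position (G : SimpleGraph V) : Type _ :=
  {e : V × V // e.1 = e.2 ∨ G.Adj e.1 e.2}

/-- Matrices in which only the entries at the edges of `G` are specified. -/
abbrev IncompleteMatrix (G : SimpleGraph V) : Type _ :=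
  Position G → ℝ

/-- The sample covariance `∑ₜ x[t] x[t]ᵀ` (not normalized). -/
def sampleCov {n : ℕ} (x : Fin n → EuclideanSpace ℝ V) : Matrix V V ℝ :=
  Matrix.of fun i j => ∑ t, x t i * x t j

/-- The incomplete sample covariance: the entries of the sample covariance at the edges of `G`. -/
def incompleteCov (G : SimpleGraph V) {n : ℕ} (x : Fin n → EuclideanSpace ℝ V) :
    IncompleteMatrix G :=
  fun e => sampleCov x e.1.1 e.1.2

/-- The block of an incomplete matrix on a complete set of nodes; all its entries are specified. -/
def block {G : SimpleGraph V} (S : IncompleteMatrix G) (A : Finset V)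
    (hA : G.IsClique (A : Set V)) : Matrix A A ℝ :=
  Matrix.of fun i j => S ⟨(i.1, j.1), by
    by_cases h : i.1 = j.1
    · exact Or.inl h
    · exact Or.inr (hA i.2 j.2 h)⟩

/-- Zero fill-in: the `V × V` matrix with block `M` on `A` and zeros elsewhere. -/
def zeroFill (A : Finset V) (M : Matrix A A ℝ) : Matrix V V ℝ :=
  Matrix.of fun i j => if h : i ∈ A ∧ j ∈ A then M ⟨i, h.1⟩ ⟨j, h.2⟩ else 0

/-! ### The closed form estimator -/

/-- `∑ₖ [(n - cₖ - 1) Sₖ⁻¹]⁰ - ∑_{k ≥ 1} [(n - sₖ - 1) S_[k]⁻¹]⁰`, where `k` counts from `0`. -/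
def closedForm {G : SimpleGraph V} {m : ℕ} {C : Fin (m + 1) → Finset V}
    (hC : IsPerfectCliqueOrder G C) (n : ℕ) (S : IncompleteMatrix G) : Matrix V V ℝ :=
  ∑ k, zeroFill (C k) (((n : ℝ) - (C k).card - 1) • (block S (C k) (hC.isClique k))⁻¹) -
    ∑ k, zeroFill (sep C k)
      (((n : ℝ) - (sep C k).card - 1) • (block S (sep C k) (hC.isClique_sep k))⁻¹)

/-- The estimator exists at `S`: all the inverses in its definition exist. -/
def ClosedFormExists {G : SimpleGraph V} {m : ℕ} {C : Fin (m + 1) → Finset V}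
    (hC : IsPerfectCliqueOrder G C) (S : IncompleteMatrix G) : Prop :=
  (∀ k, IsUnit (block S (C k) (hC.isClique k))) ∧
    ∀ k, IsUnit (block S (sep C k) (hC.isClique_sep k))

/-! ### Estimation given the incomplete sample covariance -/

/-- `T` is an unbiased estimator of `K ∈ 𝒦`, given the incomplete sample covariance of `n`
observations: it is measurable, and each entry is integrable with the right mean, for all `K`. -/
structure IsUnbiased (G : SimpleGraph V) (n : ℕ) (𝒦 : Set (Matrix V V ℝ))
    (T : IncompleteMatrix G → Matrix V V ℝ) : Prop where
  measurable : ∀ i j, Measurable fun S => T S i j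
  integrable : ∀ K ∈ 𝒦, ∀ i j, Integrable (fun x => T (incompleteCov G x) i j) (sampleLaw n K)
  mean_eq : ∀ K ∈ 𝒦, ∀ i j, ∫ x, T (incompleteCov G x) i j ∂(sampleLaw n K) = K i j

/-- The variance `E ‖T - E T‖²` (Frobenius norm) of an estimator, in `[0, ∞]`. -/
def variance (G : SimpleGraph V) (n : ℕ) (T : IncompleteMatrix G → Matrix V V ℝ)
    (K : Matrix V V ℝ) : ENNReal :=
  ∫⁻ x, ENNReal.ofReal (∑ i, ∑ j,
    (T (incompleteCov G x) i j - ∫ y, T (incompleteCov G y) i j ∂(sampleLaw n K)) ^ 2)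
    ∂(sampleLaw n K)

/-- `T` is a minimum variance unbiased estimator of `K ∈ 𝒦`, given the incomplete sample
covariance of `n` observations: it is unbiased, and its variance is at most that of any unbiased
estimator, for all `K`. -/
structure IsMVUE (G : SimpleGraph V) (n : ℕ) (𝒦 : Set (Matrix V V ℝ))
    (T : IncompleteMatrix G → Matrix V V ℝ) : Prop where
  unbiased : IsUnbiased G n 𝒦 T
  variance_le : ∀ T' : IncompleteMatrix G → Matrix V V ℝ, IsUnbiased G n 𝒦 T' →
    ∀ K ∈ 𝒦, variance G n T K ≤ variance G n T' K

end Statistics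

end GGM

/-! The argument is that of Lehmann and Scheffé: the closed form is unbiased and the incomplete
sample covariance is a complete statistic. Hence any two unbiased estimators that depend on it agree
almost surely (`IsUnbiased.ae_eq`), which gives minimality and uniqueness at once, without second
moments.

Completeness (`IsPerfectCliqueOrder.ae_eq_zero_of_integral_eq_zero`): the model consists of the
positive definite matrices that vanish at the missing edges, an open part of a linear space of
symmetric matrices. The sample laws form an exponential family whose natural statistic is the
incomplete sample covariance `S`: moving `K` to `K + t • N` multiplies the law by a constant times
`exp (t * L S)`, and every linear functional `L` arises from some `N`. A function of `S` with mean
zero throughout the model therefore has a vanishing Laplace transform near zero in every direction,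
and so vanishes almost everywhere.

Unbiasedness rests on two facts. The inverse of the sample covariance block on `A` has mean `(n -
|A| - 1)⁻¹` times the inverse covariance block (`integral_blockGram_inv`). After reduction to
standard Gaussian rows, a diagonal entry of that inverse is the reciprocal of the squared distance
of one row from the span of the others, a chi-square variable, and the off-diagonal means vanish by
symmetry. Secondly, `K` is the sum of the zero-filled inverse covariance blocks on the cliques minus
those on the separators (`IsPerfectCliqueOrder.eq_sum_localInv`), by telescoping a formula for one
decomposition along the perfect order.

Existence under the weaker bound on `n` holds because at most `n` Gaussian rows of length `n` are
almost surely linearly independent. -/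

namespace GGM

/-! ### Uniqueness of the Laplace transform. -/

/-- Two random variables whose moment generating functions exist and agree near `0` have the same
characteristic function. -/
theorem complexMGF_mul_I_eq_of_mgf_eq_near_zero {Ω Ω' : Type*} [MeasurableSpace Ω]
    [MeasurableSpace Ω'] {μ : Measure Ω} {ν : Measure Ω'} {X : Ω → ℝ} {Y : Ω' → ℝ} {ε : ℝ}
    (hε : 0 < ε) (hX : ∀ t, |t| < ε → Integrable (fun ω => Real.exp (t * X ω)) μ)
    (hY : ∀ t, |t| < ε → Integrable (fun ω => Real.exp (t * Y ω)) ν)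
    (h : ∀ t, |t| < ε → mgf X μ t = mgf Y ν t) (y : ℝ) :
    complexMGF X μ (y * Complex.I) = complexMGF Y ν (y * Complex.I) := by
  have hsub : ∀ {z : ℂ}, z.re ∈ Set.Ioo (-ε) ε → z.re ∈ interior (integrableExpSet X μ) :=
    fun {z} hz => interior_maximal (fun t ht => hX t (abs_lt.2 ht)) isOpen_Ioo hz
  have hsub' : ∀ {z : ℂ}, z.re ∈ Set.Ioo (-ε) ε → z.re ∈ interior (integrableExpSet Y ν) :=
    fun {z} hz => interior_maximal (fun t ht => hY t (abs_lt.2 ht)) isOpen_Ioo hz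
  have haX : AnalyticOnNhd ℂ (complexMGF X μ) {z | z.re ∈ Set.Ioo (-ε) ε} :=
    analyticOnNhd_complexMGF.mono fun z hz => hsub hz
  have haY : AnalyticOnNhd ℂ (complexMGF Y ν) {z | z.re ∈ Set.Ioo (-ε) ε} :=
    analyticOnNhd_complexMGF.mono fun z hz => hsub' hz
  -- Identity theorem on the strip `|Re z| < ε`: both transforms are analytic there and agree at
  -- real points accumulating at `0`, and the strip contains the imaginary axis.
  refine AnalyticOnNhd.eqOn_of_preconnected_of_frequently_eq haX haY
    ((convex_Ioo _ _).linear_preimage Complex.reLm).isPreconnected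
    (z₀ := ((0 : ℝ) : ℂ)) (by simp [hε]) ?_ (by simp [hε])
  have h_real : ∃ᶠ x : ℝ in nhdsWithin 0 {0}ᶜ, complexMGF X μ x = complexMGF Y ν x := by
    refine Filter.Eventually.frequently ?_
    have : ∀ᶠ x : ℝ in nhds 0, |x| < ε := by
      have := Metric.ball_mem_nhds (0 : ℝ) hε
      filter_upwards [this] with x hx
      simpa using hx
    filter_upwards [nhdsWithin_le_nhds this] with x hx
    rw [complexMGF_ofReal, complexMGF_ofReal, h x hx]
  rw [Filter.frequently_iff_seq_forall] at h_real ⊢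
  obtain ⟨xs, hx_tendsto, hx_eq⟩ := h_real
  refine ⟨fun n ↦ xs n, ?_, fun n ↦ ?_⟩
  · rw [tendsto_nhdsWithin_iff] at hx_tendsto ⊢
    constructor
    · rw [Filter.tendsto_ofReal_iff]
      exact hx_tendsto.1
    · simpa using hx_tendsto.2
  · simp [hx_eq]

/-- Uniqueness of the bilateral Laplace transform near `0`, for a signed measure with a density. -/
theorem ae_eq_zero_of_integral_exp_mul_eq_zero {E : Type*} [NormedAddCommGroup E]
    [NormedSpace ℝ E] [CompleteSpace E] [SecondCountableTopology E] [MeasurableSpace E]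
    [BorelSpace E] {ρ : Measure E} [IsFiniteMeasure ρ] {g : E → ℝ} (hg : Measurable g)
    (h : ∀ L : StrongDual ℝ E, ∃ ε > 0, ∀ t : ℝ, |t| < ε →
      Integrable (fun x => Real.exp (t * L x) * g x) ρ ∧
        ∫ x, Real.exp (t * L x) * g x ∂ρ = 0) :
    g =ᵐ[ρ] 0 := by
  have hg0 : Integrable g ρ := by
    obtain ⟨ε, hε, h0⟩ := h 0
    simpa using (h0 0 (by simpa using hε)).1
  -- `ENNReal.ofReal` truncates at zero, so `μ` and `ν` have the positive and negative parts of `g`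
  -- as densities. If they coincide, both parts agree almost everywhere and `g` vanishes.
  set μ := ρ.withDensity fun x => ENNReal.ofReal (g x) with hμ
  set ν := ρ.withDensity fun x => ENNReal.ofReal (-g x) with hν
  have fin : ∀ f : E → ℝ, Integrable f ρ → ∫⁻ x, ENNReal.ofReal (f x) ∂ρ ≠ ⊤ := fun f hf =>
    hf.lintegral_lt_top.ne
  have : IsFiniteMeasure μ := isFiniteMeasure_withDensity (fin _ hg0)
  have : IsFiniteMeasure ν := isFiniteMeasure_withDensity (fin _ hg0.neg)
  have hint : ∀ {f : E → ℝ}, Measurable f → ∀ {F : E → ℝ},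
      (Integrable (fun x => F x * f x) ρ) → Measurable F → (∀ x, 0 ≤ F x) →
      Integrable F (ρ.withDensity fun x => ENNReal.ofReal (f x)) ∧
      ∫ x, F x ∂(ρ.withDensity fun x => ENNReal.ofReal (f x)) =
        ∫ x, max (F x * f x) 0 ∂ρ := by
    intro f hf F hF hFm hF0
    have hfin : ∀ᵐ x ∂ρ, ENNReal.ofReal (f x) < ⊤ := by simp
    have e : ∀ x, (ENNReal.ofReal (f x)).toReal • F x = max (F x * f x) 0 := fun x => by
      rw [ENNReal.toReal_ofReal', smul_eq_mul, max_mul_of_nonneg _ _ (hF0 x), zero_mul,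
        mul_comm]
    constructor
    · rw [integrable_withDensity_iff_integrable_smul₀' (by fun_prop) hfin]
      simp_rw [e]
      exact hF.pos_part
    · rw [integral_withDensity_eq_integral_toReal_smul (by fun_prop) hfin]
      simp_rw [e]
  have key : μ = ν := by
    refine Measure.ext_of_charFunDual (funext fun L => ?_)
    obtain ⟨ε, hε, hL⟩ := h L
    have hm : ∀ t : ℝ, Measurable fun x => Real.exp (t * L x) := fun t => by fun_prop
    have h1 := fun t (ht : |t| < ε) =>
      hint hg (hL t ht).1 (hm t) fun x => (Real.exp_pos _).le
    have hneg : ∀ t, |t| < ε → Integrable (fun x => Real.exp (t * L x) * -g x) ρ := fun t ht => by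
      simpa using (hL t ht).1.neg
    have h2 := fun t (ht : |t| < ε) =>
      hint hg.neg (hneg t ht) (hm t) fun x => (Real.exp_pos _).le
    have := complexMGF_mul_I_eq_of_mgf_eq_near_zero (X := L) (Y := L) hε
      (fun t ht => (h1 t ht).1) (fun t ht => (h2 t ht).1) (fun t ht => ?_) 1
    · rw [charFunDual_apply, charFunDual_apply]
      simpa [complexMGF, mul_comm] using this
    -- The two moment generating functions integrate the positive and negative parts of `exp (t * L
    -- x) * g x`, so their difference is the integral assumed to vanish.
    · rw [mgf, mgf, (h1 t ht).2, (h2 t ht).2, ← sub_eq_zero, ← integral_sub]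
      · refine (integral_congr_ae (.of_forall fun x => ?_)).trans (hL t ht).2
        dsimp only [Pi.neg_apply]
        rcases le_total 0 (Real.exp (t * L x) * g x) with h0 | h0
        · rw [max_eq_left h0, max_eq_right (by linarith)]; ring
        · rw [max_eq_right h0, max_eq_left (by linarith)]; ring
      · exact (hL t ht).1.pos_part
      · exact (hneg t ht).pos_part
  rw [hμ, hν, withDensity_eq_iff (by fun_prop) (by fun_prop) (fin _ hg0)] at key
  filter_upwards [key] with x hx
  rcases le_total 0 (g x) with h0 | h0
  · rw [ENNReal.ofReal_eq_zero.2 (by linarith : -g x ≤ 0), ENNReal.ofReal_eq_zero] at hx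
    exact le_antisymm hx h0
  · rw [ENNReal.ofReal_eq_zero.2 h0, eq_comm, ENNReal.ofReal_eq_zero] at hx
    exact le_antisymm h0 (neg_nonpos.1 hx)

/-! ### Gaussian densities and change of the concentration matrix. -/

theorem pi_withDensity_ofReal {ι : Type*} [Fintype ι] {α : ι → Type*}
    [∀ i, MeasurableSpace (α i)] (μ : ∀ i, Measure (α i)) [∀ i, SigmaFinite (μ i)]
    (f : ∀ i, α i → ℝ) (hf : ∀ i, Integrable (f i) (μ i)) (hf0 : ∀ i x, 0 ≤ f i x) :
    Measure.pi (fun i => (μ i).withDensity fun x => ENNReal.ofReal (f i x)) =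
      (Measure.pi μ).withDensity fun x => ENNReal.ofReal (∏ i, f i (x i)) := by
  have hfin : ∀ i, ∀ᵐ x ∂(μ i), ENNReal.ofReal (f i x) ≠ ⊤ := fun i => by simp
  have : ∀ i, SigmaFinite ((μ i).withDensity fun x => ENNReal.ofReal (f i x)) := fun i =>
    SigmaFinite.withDensity_of_ne_top (hfin i)
  refine Measure.pi_eq fun s hs => ?_
  rw [withDensity_apply _ (MeasurableSet.univ_pi hs), Measure.restrict_pi_pi,
    ← ofReal_integral_eq_lintegral_ofReal (Integrable.fintype_prod_dep fun i => (hf i).restrict)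
      (.of_forall fun x => Finset.prod_nonneg fun i _ => hf0 i _),
    integral_fintype_prod_eq_prod,
    ENNReal.ofReal_prod_of_nonneg fun i _ => integral_nonneg fun x => hf0 i x]
  refine Finset.prod_congr rfl fun i _ => ?_
  rw [withDensity_apply _ (hs i),
    ofReal_integral_eq_lintegral_ofReal (hf i).restrict (.of_forall fun x => hf0 i x)]

theorem map_withDensity_comp {α β : Type*} [MeasurableSpace α] [MeasurableSpace β]
    (μ : Measure α) {T : α → β} (hT : Measurable T) {f : β → ENNReal} (hf : Measurable f) :
    (μ.withDensity fun x => f (T x)).map T = (μ.map T).withDensity f := by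
  ext s hs
  rw [Measure.map_apply hT hs, withDensity_apply _ (hT hs), withDensity_apply _ hs,
    setLIntegral_map hs hf hT]

section Density

variable {ι : Type*} [Fintype ι]

theorem stdGaussian_eq_withDensity : stdGaussian (EuclideanSpace ℝ ι) =
    volume.withDensity fun x => ENNReal.ofReal
      ((√(2 * Real.pi))⁻¹ ^ Fintype.card ι * Real.exp (-(x.ofLp ⬝ᵥ x.ofLp) / 2)) := by
  have h : ∀ x : ι → ℝ, ∏ i, gaussianPDFReal 0 1 (x i) =
      (√(2 * Real.pi))⁻¹ ^ Fintype.card ι * Real.exp (-(x ⬝ᵥ x) / 2) := fun x => by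
    simp only [gaussianPDFReal, Finset.prod_mul_distrib, ← Real.exp_sum, dotProduct]
    simp [neg_div, Finset.sum_div, sq]
  rw [← map_pi_eq_stdGaussian, gaussianReal_of_var_ne_zero 0 one_ne_zero]
  simp only [gaussianPDF_def]
  rw [pi_withDensity_ofReal _ _ (fun _ => integrable_gaussianPDFReal 0 1)
    (fun _ => gaussianPDFReal_nonneg 0 1)]
  simp_rw [h]
  have := map_withDensity_comp (Measure.pi fun _ : ι => (volume : Measure ℝ))
    (T := WithLp.toLp 2) (by fun_prop) (f := fun x : EuclideanSpace ℝ ι => ENNReal.ofReal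
      ((√(2 * Real.pi))⁻¹ ^ Fintype.card ι * Real.exp (-(x.ofLp ⬝ᵥ x.ofLp) / 2)))
      (by unfold dotProduct; fun_prop)
  rw [← volume_pi, (PiLp.volume_preserving_toLp ι).map_eq] at this
  exact this

variable [DecidableEq ι]

-- The law is the image of the standard one under the symmetric root `R` of `K⁻¹`. Since `R * K * R
-- = 1`, the form of `K` at `R x` is `x ⬝ᵥ x`, and the Jacobian `|det R|⁻¹` is `√(det K)`.
open scoped MatrixOrder in
theorem multivariateGaussian_eq_withDensity {K : Matrix ι ι ℝ} (hK : K.PosDef) :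
    multivariateGaussian 0 K⁻¹ = volume.withDensity fun x => ENNReal.ofReal
      ((√(2 * Real.pi))⁻¹ ^ Fintype.card ι * √K.det *
        Real.exp (-(x.ofLp ⬝ᵥ K.mulVec x.ofLp) / 2)) := by
  set R := CFC.sqrt K⁻¹ with hR
  have hdet : IsUnit K.det := (Matrix.isUnit_iff_isUnit_det _).1 hK.isUnit
  have hRR : R * R = K⁻¹ := CFC.sqrt_mul_sqrt_self _ hK.inv.posSemidef.nonneg
  have hRT : R.transpose = R := (CFC.sqrt_nonneg K⁻¹).isSelfAdjoint.star_eq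
  have hdR : R.det * R.det = K.det⁻¹ := by
    rw [← Matrix.det_mul, hRR, Matrix.det_nonsing_inv, Ring.inverse_eq_inv']
  have hdR0 : R.det ≠ 0 := fun h => by
    rw [h, zero_mul, eq_comm, inv_eq_zero] at hdR
    exact hdet.ne_zero hdR
  have hRKR : R * K * R = 1 := by
    have hu : IsUnit R.det := hdR0.isUnit
    have : R * (R * K * R) = R * 1 := by
      rw [← mul_assoc, ← mul_assoc, hRR, Matrix.nonsing_inv_mul _ hdet, one_mul, mul_one]
    have := congrArg (R⁻¹ * ·) this
    simpa [← mul_assoc, Matrix.nonsing_inv_mul _ hu] using this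
  have hquad : ∀ x : EuclideanSpace ℝ ι,
      (Matrix.toEuclideanCLM (𝕜 := ℝ) R x).ofLp ⬝ᵥ
        K.mulVec (Matrix.toEuclideanCLM (𝕜 := ℝ) R x).ofLp = x.ofLp ⬝ᵥ x.ofLp := fun x => by
    rw [Matrix.ofLp_toEuclideanCLM, Matrix.mulVec_mulVec, dotProduct_comm,
      Matrix.dotProduct_mulVec, ← Matrix.mulVec_transpose, Matrix.mulVec_mulVec, hRT, ← mul_assoc,
      hRKR, Matrix.one_mulVec]
  have habs : |R.det⁻¹| = √K.det := by
    rw [eq_comm, Real.sqrt_eq_iff_mul_self_eq hK.det_pos.le (abs_nonneg _), abs_mul_abs_self,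
      ← mul_inv, hdR, inv_inv]
  have hmap : (volume : Measure (EuclideanSpace ℝ ι)).map (Matrix.toEuclideanCLM (𝕜 := ℝ) R) =
      ENNReal.ofReal √K.det • volume := by
    have hd : LinearMap.det (Matrix.toLpLin 2 2 R) = R.det := by
      rw [Matrix.toLpLin_eq_toLin, LinearMap.det_toLin]
    have := Measure.map_linearMap_addHaar_eq_smul_addHaar
      (volume : Measure (EuclideanSpace ℝ ι)) (f := Matrix.toLpLin 2 2 R) (by rwa [hd])
    rw [hd, habs] at this
    exact this
  have hm : Measurable fun x : EuclideanSpace ℝ ι => ENNReal.ofReal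
      ((√(2 * Real.pi))⁻¹ ^ Fintype.card ι * Real.exp (-(x.ofLp ⬝ᵥ K.mulVec x.ofLp) / 2)) := by
    unfold dotProduct Matrix.mulVec dotProduct; fun_prop
  have h := map_withDensity_comp (volume : Measure (EuclideanSpace ℝ ι))
    (T := Matrix.toEuclideanCLM (𝕜 := ℝ) R) (by fun_prop) hm
  simp_rw [hquad] at h
  rw [← stdGaussian_eq_withDensity, hmap, withDensity_smul_measure,
    ← withDensity_smul _ hm] at h
  rw [multivariateGaussian]
  simp only [zero_add]
  rw [← hR, h]
  congr 1 with x
  rw [Pi.smul_apply, smul_eq_mul, ← ENNReal.ofReal_mul (by positivity)]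
  congr 1
  ring

/-- The Gaussian integral of a positive definite quadratic form. -/
theorem lintegral_exp_neg_quadratic {M : Matrix ι ι ℝ} (hM : M.PosDef) :
    ∫⁻ x : EuclideanSpace ℝ ι, ENNReal.ofReal (Real.exp (-(x.ofLp ⬝ᵥ M.mulVec x.ofLp) / 2)) =
      ENNReal.ofReal ((√(2 * Real.pi))⁻¹ ^ Fintype.card ι * √M.det)⁻¹ := by
  -- The total mass is one, so the integral is the reciprocal of the normalizing constant of the
  -- density.
  have h1 : multivariateGaussian 0 M⁻¹ Set.univ = 1 := measure_univ
  have hd := hM.det_pos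
  have hc : 0 < (√(2 * Real.pi))⁻¹ ^ Fintype.card ι * √M.det := by positivity
  rw [multivariateGaussian_eq_withDensity hM, withDensity_apply _ MeasurableSet.univ,
    setLIntegral_univ] at h1
  simp_rw [ENNReal.ofReal_mul hc.le] at h1
  rw [lintegral_const_mul _ (by unfold dotProduct Matrix.mulVec dotProduct; fun_prop)] at h1
  rw [ENNReal.ofReal_inv_of_pos hc]
  exact ENNReal.eq_inv_of_mul_eq_one_left (by rwa [mul_comm])

/-- The Laplace transform of a quadratic form in independent standard Gaussian variables. -/
theorem lintegral_exp_neg_quadratic_pi_gaussianReal {Q : Matrix ι ι ℝ} (hQ : (1 + Q).PosDef) :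
    ∫⁻ x, ENNReal.ofReal (Real.exp (-(x ⬝ᵥ Q.mulVec x) / 2))
      ∂(Measure.pi fun _ : ι => gaussianReal 0 1) = ENNReal.ofReal (√(1 + Q).det)⁻¹ := by
  have hm : Measurable fun x : EuclideanSpace ℝ ι =>
      ENNReal.ofReal (Real.exp (-(x.ofLp ⬝ᵥ Q.mulVec x.ofLp) / 2)) := by
    unfold dotProduct Matrix.mulVec dotProduct; fun_prop
  have h := lintegral_map (μ := Measure.pi fun _ : ι => gaussianReal 0 1) hm
    (g := WithLp.toLp 2) (by fun_prop)
  rw [← h, map_pi_eq_stdGaussian, stdGaussian_eq_withDensity,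
    lintegral_withDensity_eq_lintegral_mul _ (by unfold dotProduct; fun_prop) hm]
  have hd := hQ.det_pos
  have e : ∀ x : EuclideanSpace ℝ ι,
      ENNReal.ofReal ((√(2 * Real.pi))⁻¹ ^ Fintype.card ι *
        Real.exp (-(x.ofLp ⬝ᵥ x.ofLp) / 2)) *
        ENNReal.ofReal (Real.exp (-(x.ofLp ⬝ᵥ Q.mulVec x.ofLp) / 2)) =
      ENNReal.ofReal ((√(2 * Real.pi))⁻¹ ^ Fintype.card ι) *
        ENNReal.ofReal (Real.exp (-(x.ofLp ⬝ᵥ (1 + Q).mulVec x.ofLp) / 2)) := fun x => by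
    rw [← ENNReal.ofReal_mul (by positivity), ← ENNReal.ofReal_mul (by positivity), mul_assoc,
      ← Real.exp_add, Matrix.add_mulVec, Matrix.one_mulVec, dotProduct_add]
    ring_nf
  simp only [Pi.mul_apply, e]
  rw [lintegral_const_mul _ (by unfold dotProduct Matrix.mulVec dotProduct; fun_prop),
    lintegral_exp_neg_quadratic hQ, ← ENNReal.ofReal_mul (by positivity)]
  congr 1
  have : (√(2 * Real.pi))⁻¹ ^ Fintype.card ι ≠ 0 := by positivity
  rw [mul_inv, mul_inv_cancel_left₀ this]

/-- Change of the concentration matrix in a Gaussian law. -/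
theorem multivariateGaussian_eq_withDensity_multivariateGaussian {K K' : Matrix ι ι ℝ}
    (hK : K.PosDef) (hK' : K'.PosDef) :
    multivariateGaussian 0 K'⁻¹ = (multivariateGaussian 0 K⁻¹).withDensity fun x =>
      ENNReal.ofReal ((√K'.det / √K.det) *
        Real.exp (-(x.ofLp ⬝ᵥ (K' - K).mulVec x.ofLp) / 2)) := by
  have hd := hK.det_pos
  rw [multivariateGaussian_eq_withDensity hK, multivariateGaussian_eq_withDensity hK',
    ← withDensity_mul _ (by unfold dotProduct Matrix.mulVec dotProduct; fun_prop)
      (by unfold dotProduct Matrix.mulVec dotProduct; fun_prop)]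
  congr 1 with x
  rw [Pi.mul_apply, ← ENNReal.ofReal_mul (by positivity)]
  congr 1
  have h0 : √K.det ≠ 0 := by positivity
  have : Real.exp (-(x.ofLp ⬝ᵥ K'.mulVec x.ofLp) / 2) =
      Real.exp (-(x.ofLp ⬝ᵥ K.mulVec x.ofLp) / 2) *
        Real.exp (-(x.ofLp ⬝ᵥ (K' - K).mulVec x.ofLp) / 2) := by
    rw [← Real.exp_add, Matrix.sub_mulVec, dotProduct_sub]
    ring_nf
  rw [this]
  field_simp

/-- This is the exponential family structure: the likelihood ratio depends on the sample only
through a linear function of its sample covariance. -/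
theorem pi_multivariateGaussian_eq_withDensity {K K' : Matrix ι ι ℝ}
    (hK : K.PosDef) (hK' : K'.PosDef) (n : ℕ) :
    Measure.pi (fun _ : Fin n => multivariateGaussian 0 K'⁻¹) =
      (Measure.pi fun _ : Fin n => multivariateGaussian 0 K⁻¹).withDensity fun x =>
        ENNReal.ofReal ((√K'.det / √K.det) ^ n *
          Real.exp (-(∑ t, (x t).ofLp ⬝ᵥ (K' - K).mulVec (x t).ofLp) / 2)) := by
  have hd := hK.det_pos
  have hf : Integrable (fun x : EuclideanSpace ℝ ι => (√K'.det / √K.det) *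
        Real.exp (-(x.ofLp ⬝ᵥ (K' - K).mulVec x.ofLp) / 2)) (multivariateGaussian 0 K⁻¹) := by
    refine ⟨Measurable.aestronglyMeasurable
      (by unfold dotProduct Matrix.mulVec dotProduct; fun_prop), ?_⟩
    rw [hasFiniteIntegral_iff_ofReal (.of_forall fun x => by positivity)]
    have : multivariateGaussian 0 K'⁻¹ Set.univ = 1 := measure_univ
    rw [multivariateGaussian_eq_withDensity_multivariateGaussian hK hK',
      withDensity_apply _ MeasurableSet.univ, setLIntegral_univ] at this
    rw [this]
    exact ENNReal.one_lt_top
  rw [multivariateGaussian_eq_withDensity_multivariateGaussian hK hK',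
    pi_withDensity_ofReal _ _ (fun _ => hf) (fun _ x => by positivity)]
  congr 1 with x
  rw [Finset.prod_mul_distrib, ← Real.exp_sum]
  simp [neg_div, Finset.sum_div, div_pow]

end Density

/-! ### Gram matrices, projections and Schur complements. -/

section GramMatrix

/-- The Gram matrix of the rows of `Z`. -/
def gram {ι κ : Type*} [Fintype κ] (Z : ι → κ → ℝ) : Matrix ι ι ℝ :=
  Matrix.of Z * (Matrix.of Z).transpose

/-- The orthogonal projection onto the orthogonal complement of the rows of `Y`, provided that the
rows are linearly independent. -/
noncomputable def rowCoprojection {ι κ : Type*} [Fintype ι] [DecidableEq ι] [Fintype κ]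
    [DecidableEq κ] (Y : ι → κ → ℝ) : Matrix κ κ ℝ :=
  1 - (Matrix.of Y).transpose * (gram Y)⁻¹ * Matrix.of Y

theorem gram_transpose {ι κ : Type*} [Fintype κ] (Y : ι → κ → ℝ) : (gram Y).transpose = gram Y := by
  simp [gram, Matrix.transpose_mul]

theorem posSemidef_gram {ι κ : Type*} [Finite ι] [Fintype κ] (Y : ι → κ → ℝ) : (gram Y).PosSemidef := by
  have := Matrix.posSemidef_self_mul_conjTranspose (Matrix.of Y)
  rwa [Matrix.conjTranspose_eq_transpose_of_trivial] at this

variable {ι κ : Type*} [Fintype ι] [DecidableEq ι] [Fintype κ] [DecidableEq κ]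

theorem of_mul_rowCoprojection {Y : ι → κ → ℝ} (hY : (gram Y).det ≠ 0) :
    Matrix.of Y * rowCoprojection Y = 0 := by
  rw [rowCoprojection, Matrix.mul_sub, Matrix.mul_one, ← Matrix.mul_assoc, ← Matrix.mul_assoc, ← gram,
    Matrix.mul_nonsing_inv _ hY.isUnit, Matrix.one_mul, sub_self]

theorem rowCoprojection_transpose (Y : ι → κ → ℝ) :
    (rowCoprojection Y).transpose = rowCoprojection Y := by
  simp [rowCoprojection, Matrix.transpose_mul, Matrix.transpose_nonsing_inv, gram_transpose,
    Matrix.mul_assoc]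

theorem posSemidef_rowCoprojection {Y : ι → κ → ℝ} (hY : (gram Y).det ≠ 0) :
    (rowCoprojection Y).PosSemidef := by
  have h : (rowCoprojection Y).conjTranspose * rowCoprojection Y = rowCoprojection Y := by
    rw [Matrix.conjTranspose_eq_transpose_of_trivial, rowCoprojection_transpose]
    nth_rewrite 1 [rowCoprojection]
    rw [Matrix.sub_mul, Matrix.mul_assoc, of_mul_rowCoprojection hY, Matrix.mul_zero, sub_zero,
      Matrix.one_mul]
  rw [← h]
  exact Matrix.posSemidef_conjTranspose_mul_self _

/-- The projection has eigenvalue `1` on a space of dimension `card κ - card ι` and `0` on its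
complement. The identity `det (1 + A * B) = det (1 + B * A)` gives the result without
diagonalization, and the quotient avoids truncated subtraction. -/
theorem det_one_add_smul_rowCoprojection {Y : ι → κ → ℝ} (hY : (gram Y).det ≠ 0) {s : ℝ}
    (hs : 0 < s) : (1 + (s - 1) • rowCoprojection Y).det =
      s ^ Fintype.card κ / s ^ Fintype.card ι := by
  have h : 1 + (s - 1) • rowCoprojection Y =
      s • (1 + (Matrix.of Y).transpose * ((-((s - 1) / s)) • ((gram Y)⁻¹ * Matrix.of Y))) := by
    rw [rowCoprojection, smul_add, Matrix.mul_smul, smul_smul, ← Matrix.mul_assoc, smul_sub,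
      mul_neg, mul_div_cancel₀ _ hs.ne']
    module
  rw [h, Matrix.det_smul, Matrix.det_one_add_mul_comm, Matrix.smul_mul, Matrix.mul_assoc, ← gram,
    Matrix.nonsing_inv_mul _ hY.isUnit]
  have : (1 : Matrix ι ι ℝ) + -((s - 1) / s) • 1 = s⁻¹ • 1 := by
    have : s⁻¹ = 1 + -((s - 1) / s) := by field_simp; ring
    rw [this, add_smul, one_smul]
  rw [this, Matrix.det_smul, Matrix.det_one, mul_one, inv_pow, div_eq_mul_inv]

end GramMatrix

section SchurComplement

theorem gram_submatrix_succAbove {c : ℕ} {κ : Type*} [Fintype κ] (i : Fin (c + 1)) (Z : Fin (c + 1) → κ → ℝ) :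
    (gram Z).submatrix i.succAbove i.succAbove = gram fun j => Z (i.succAbove j) := by
  ext j k
  simp [gram, Matrix.mul_apply]

theorem adjugate_gram_apply_self {c : ℕ} {κ : Type*} [Fintype κ] (i : Fin (c + 1)) (Z : Fin (c + 1) → κ → ℝ) :
    (gram Z).adjugate i i = (gram fun j => Z (i.succAbove j)).det := by
  rw [Matrix.adjugate_fin_succ_eq_det_submatrix, gram_submatrix_succAbove,
    Even.neg_one_pow ⟨_, rfl⟩, one_mul]

variable {c : ℕ} {κ : Type*} [Fintype κ] [DecidableEq κ]

/-- The vector `u` holds the coefficients of the residual of row `i` after projection onto the other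
rows. The residual is orthogonal to those rows, so `gram Z` maps `u` to a multiple of the `i`th unit
vector; applying the adjugate and reading entry `i`, where `u` is `1`, gives the identity. -/
theorem det_gram_eq (i : Fin (c + 1)) (Z : Fin (c + 1) → κ → ℝ)
    (hY : (gram fun j => Z (i.succAbove j)).det ≠ 0) :
    (gram Z).det = (gram fun j => Z (i.succAbove j)).det *
      (Z i ⬝ᵥ (rowCoprojection fun j => Z (i.succAbove j)).mulVec (Z i)) := by
  set Y : Fin c → κ → ℝ := fun j => Z (i.succAbove j) with hYdef
  set u : Fin (c + 1) → ℝ :=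
    Fin.insertNth i (1 : ℝ) (-((gram Y)⁻¹.mulVec ((Matrix.of Y).mulVec (Z i)))) with hu
  have h1 : (Matrix.of Z).transpose.mulVec u = (rowCoprojection Y).mulVec (Z i) := by
    have : (Matrix.of Z).transpose.mulVec u = Z i + (Matrix.of Y).transpose.mulVec
        (-((gram Y)⁻¹.mulVec ((Matrix.of Y).mulVec (Z i)))) := by
      ext k
      simp only [Matrix.mulVec, dotProduct, Matrix.transpose_apply, Matrix.of_apply, Pi.add_apply,
        Fin.sum_univ_succAbove _ i, hu, Fin.insertNth_apply_same, mul_one,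
        Fin.insertNth_apply_succAbove, hYdef]
    rw [this, rowCoprojection, Matrix.sub_mulVec, Matrix.one_mulVec, Matrix.mulVec_neg,
      Matrix.mulVec_mulVec, Matrix.mulVec_mulVec, sub_eq_add_neg]
  have h2 : (gram Z).mulVec u = Pi.single i (Z i ⬝ᵥ (rowCoprojection Y).mulVec (Z i)) := by
    rw [gram, ← Matrix.mulVec_mulVec, h1]
    ext j
    rcases Fin.eq_self_or_eq_succAbove i j with rfl | ⟨j, rfl⟩
    · simp [Matrix.mulVec]
    · rw [Pi.single_eq_of_ne (Fin.succAbove_ne i j)]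
      have := congrFun (congrArg (fun M => M.mulVec (Z i)) (of_mul_rowCoprojection hY)) j
      rw [← Matrix.mulVec_mulVec, Matrix.zero_mulVec] at this
      exact this
  have h3 := congrFun (congrArg (gram Z).adjugate.mulVec h2) i
  rw [Matrix.mulVec_mulVec, Matrix.adjugate_mul, Matrix.smul_mulVec, Matrix.one_mulVec,
    Pi.smul_apply, Matrix.mulVec_single] at h3
  simpa [hu, adjugate_gram_apply_self, mul_comm] using h3

theorem gram_inv_apply_self (i : Fin (c + 1)) (Z : Fin (c + 1) → κ → ℝ)
    (hY : (gram fun j => Z (i.succAbove j)).det ≠ 0) :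
    (gram Z)⁻¹ i i =
      (Z i ⬝ᵥ (rowCoprojection fun j => Z (i.succAbove j)).mulVec (Z i))⁻¹ := by
  rw [Matrix.inv_def, Ring.inverse_eq_inv', Matrix.smul_apply, adjugate_gram_apply_self,
    det_gram_eq i Z hY, smul_eq_mul, mul_inv, mul_comm, mul_inv_cancel_left₀ hY]

end SchurComplement

/-! ### Measurability of matrix functions, and standard Gaussian arrays. -/

theorem measurable_det_of_measurable {α ι : Type*} [MeasurableSpace α] [Fintype ι]
    [DecidableEq ι] {M : α → Matrix ι ι ℝ} (hM : ∀ i j, Measurable fun a => M a i j) :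
    Measurable fun a => (M a).det := by
  simp only [Matrix.det_apply]
  fun_prop

theorem measurable_inv_apply_of_measurable {α ι : Type*} [MeasurableSpace α] [Fintype ι]
    [DecidableEq ι] {M : α → Matrix ι ι ℝ} (hM : ∀ i j, Measurable fun a => M a i j) (i j : ι) :
    Measurable fun a => (M a)⁻¹ i j := by
  simp only [Matrix.inv_def, Ring.inverse_eq_inv', Matrix.smul_apply, Matrix.adjugate_apply]
  refine (measurable_det_of_measurable hM).inv.smul (measurable_det_of_measurable fun k l => ?_)
  simp only [Matrix.updateRow_apply]
  split_ifs
  · exact measurable_const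
  · exact hM k l

theorem measurable_gram_apply {ι κ : Type*} [Fintype κ] (i j : ι) :
    Measurable fun Z : ι → κ → ℝ => gram Z i j := by
  simp only [gram, Matrix.mul_apply, Matrix.of_apply, Matrix.transpose_apply]
  fun_prop

theorem measurable_det_gram {ι κ : Type*} [Fintype ι] [DecidableEq ι] [Fintype κ] :
    Measurable fun Z : ι → κ → ℝ => (gram Z).det :=
  measurable_det_of_measurable measurable_gram_apply

theorem measurable_dotProduct_mulVec {κ : Type*} [Fintype κ] (Q : Matrix κ κ ℝ) :
    Measurable fun z : κ → ℝ => z ⬝ᵥ Q.mulVec z := by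
  unfold dotProduct Matrix.mulVec dotProduct; fun_prop

/-- The law of a standard Gaussian random vector. -/
noncomputable abbrev stdVector (κ : Type*) [Fintype κ] : Measure (κ → ℝ) :=
  Measure.pi fun _ => gaussianReal 0 1

/-- The law of a matrix, given by its rows, with independent standard Gaussian entries. -/
noncomputable abbrev stdRows (ι κ : Type*) [Fintype ι] [Fintype κ] : Measure (ι → κ → ℝ) :=
  Measure.pi fun _ => stdVector κ

/-! ### Chi-square laws of projected Gaussian vectors. -/

section Residual

variable {ι κ : Type*} [Fintype ι] [DecidableEq ι] [Fintype κ] [DecidableEq κ]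

/-- The squared norm of the projection of a standard Gaussian vector has the Laplace transform of
a chi-square variable. -/
theorem lintegral_exp_neg_rowCoprojection {Y : ι → κ → ℝ} (hY : (gram Y).det ≠ 0)
    (hc : Fintype.card ι ≤ Fintype.card κ) {s : ℝ} (hs : 1 ≤ s) :
    ∫⁻ z, ENNReal.ofReal (Real.exp (-((s - 1) * (z ⬝ᵥ (rowCoprojection Y).mulVec z)) / 2))
      ∂(stdVector κ) = ENNReal.ofReal (√(s ^ (Fintype.card κ - Fintype.card ι)))⁻¹ := by
  have h := lintegral_exp_neg_quadratic_pi_gaussianReal (Q := (s - 1) • rowCoprojection Y)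
    (Matrix.PosDef.one.add_posSemidef
      ((posSemidef_rowCoprojection hY).smul (sub_nonneg.2 hs)))
  rw [det_one_add_smul_rowCoprojection hY (by linarith),
    ← pow_sub₀ _ (by positivity) hc |>.trans (div_eq_mul_inv _ _).symm] at h
  simpa only [Matrix.smul_mulVec, dotProduct_smul, smul_eq_mul] using h

/-- The event that the form vanishes has mass at most the Laplace transform at every `s ≥ 1`. That
transform tends to `0` as `s` grows, because its exponent `card κ - card ι` is positive. -/
theorem ae_rowCoprojection_pos {Y : ι → κ → ℝ} (hY : (gram Y).det ≠ 0)
    (hc : Fintype.card ι < Fintype.card κ) :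
    ∀ᵐ z ∂(stdVector κ), 0 < z ⬝ᵥ (rowCoprojection Y).mulVec z := by
  have h0 : ∀ z, 0 ≤ z ⬝ᵥ (rowCoprojection Y).mulVec z := fun z => by
    simpa using (posSemidef_rowCoprojection hY).dotProduct_mulVec_nonneg z
  have hle : ∀ s : ℝ, 1 ≤ s → stdVector κ {z | z ⬝ᵥ (rowCoprojection Y).mulVec z = 0} ≤
      ENNReal.ofReal (√s)⁻¹ := fun s hs => by
    have hm : MeasurableSet {z | z ⬝ᵥ (rowCoprojection Y).mulVec z = 0} :=
      measurable_dotProduct_mulVec _ (measurableSet_singleton 0)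
    calc stdVector κ {z | z ⬝ᵥ (rowCoprojection Y).mulVec z = 0}
        = ∫⁻ z, Set.indicator {z | z ⬝ᵥ (rowCoprojection Y).mulVec z = 0} 1 z ∂(stdVector κ) :=
          (lintegral_indicator_one hm).symm
      _ ≤ ∫⁻ z, ENNReal.ofReal (Real.exp (-((s - 1) * (z ⬝ᵥ (rowCoprojection Y).mulVec z)) / 2))
            ∂(stdVector κ) := by
          refine lintegral_mono fun z => ?_
          simp only [Set.indicator_apply, Set.mem_ofPred_eq]
          split_ifs with hz
          · simp [hz]
          · exact zero_le
      _ = ENNReal.ofReal (√(s ^ (Fintype.card κ - Fintype.card ι)))⁻¹ :=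
          lintegral_exp_neg_rowCoprojection hY hc.le hs
      _ ≤ ENNReal.ofReal (√s)⁻¹ := by
          have : s ≤ s ^ (Fintype.card κ - Fintype.card ι) :=
            le_self_pow₀ hs (Nat.sub_ne_zero_of_lt hc)
          gcongr
  have hlim : Filter.Tendsto (fun s : ℝ => ENNReal.ofReal (√s)⁻¹) Filter.atTop (nhds 0) := by
    rw [← ENNReal.ofReal_zero]
    exact ENNReal.tendsto_ofReal (tendsto_inv_atTop_zero.comp Real.tendsto_sqrt_atTop)
  have h := ge_of_tendsto hlim ((Filter.eventually_ge_atTop 1).mono hle)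
  have : ∀ᵐ z ∂(stdVector κ), z ⬝ᵥ (rowCoprojection Y).mulVec z ≠ 0 := by
    rw [ae_iff]
    simpa using h
  filter_upwards [this] with z hz using lt_of_le_of_ne (h0 z) hz.symm

/-- Writing `q⁻¹` as a mixture of exponentials lets Tonelli reduce the mean of a reciprocal
chi-square variable to its Laplace transform. -/
theorem lintegral_Ioi_exp_eq_inv {q : ℝ} (hq : 0 < q) :
    ∫⁻ s in Set.Ioi (1 : ℝ), ENNReal.ofReal (1 / 2) *
      ENNReal.ofReal (Real.exp (-((s - 1) * q) / 2)) = ENNReal.ofReal q⁻¹ := by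
  have e : ∀ s : ℝ, Real.exp (-((s - 1) * q) / 2) =
      Real.exp (q / 2) * Real.exp (-(q / 2) * s) := fun s => by
    rw [← Real.exp_add]; ring_nf
  have hneg : -(q / 2) < 0 := by linarith
  rw [lintegral_const_mul _ (by fun_prop)]
  simp_rw [e]
  rw [← ofReal_integral_eq_lintegral_ofReal
    ((integrableOn_exp_mul_Ioi hneg 1).const_mul _) (.of_forall fun s => by positivity),
    integral_const_mul, integral_exp_mul_Ioi hneg, ← ENNReal.ofReal_mul (by norm_num)]
  congr 1
  have : Real.exp (q / 2) * Real.exp (-(q / 2) * 1) = 1 := by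
    rw [← Real.exp_add]; simp
  rw [neg_div_neg_eq, mul_div_assoc', this]
  field_simp

/-- The integrand is `s ^ (-d / 2) / 2`, which is integrable at infinity exactly when `d > 2`. -/
theorem lintegral_Ioi_inv_sqrt_pow {d : ℕ} (hd : 3 ≤ d) :
    ∫⁻ s in Set.Ioi (1 : ℝ), ENNReal.ofReal (1 / 2) * ENNReal.ofReal (√(s ^ d))⁻¹ =
      ENNReal.ofReal ((d : ℝ) - 2)⁻¹ := by
  have hd' : (3 : ℝ) ≤ d := by exact_mod_cast hd
  have e : ∀ s ∈ Set.Ioi (1 : ℝ), ENNReal.ofReal (√(s ^ d))⁻¹ =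
      ENNReal.ofReal (s ^ (-(d / 2 : ℝ))) := fun s hs => by
    have hs : (0 : ℝ) < s := one_pos.trans hs
    rw [Real.sqrt_eq_rpow, ← Real.rpow_natCast, ← Real.rpow_mul hs.le, Real.rpow_neg hs.le]
    ring_nf
  have ha : -(d / 2 : ℝ) < -1 := by linarith
  rw [lintegral_const_mul _ (by fun_prop), setLIntegral_congr_fun measurableSet_Ioi e,
    ← ofReal_integral_eq_lintegral_ofReal (integrableOn_Ioi_rpow_of_lt ha one_pos)
      (ae_restrict_of_forall_mem measurableSet_Ioi fun s hs =>
        Real.rpow_nonneg (one_pos.trans hs).le _),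
    integral_Ioi_rpow_of_lt ha one_pos, ← ENNReal.ofReal_mul (by norm_num), Real.one_rpow]
  congr 1
  have : (d : ℝ) - 2 ≠ 0 := by linarith
  have : -(d / 2 : ℝ) + 1 = -((d - 2) / 2) := by ring
  rw [this]
  field_simp

/-- The mean of the reciprocal of a chi-square variable. -/
theorem lintegral_inv_rowCoprojection {Y : ι → κ → ℝ} (hY : (gram Y).det ≠ 0)
    (hc : Fintype.card ι + 3 ≤ Fintype.card κ) :
    ∫⁻ z, ENNReal.ofReal (z ⬝ᵥ (rowCoprojection Y).mulVec z)⁻¹ ∂(stdVector κ) =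
      ENNReal.ofReal ((Fintype.card κ : ℝ) - Fintype.card ι - 2)⁻¹ := by
  have hm := measurable_dotProduct_mulVec (rowCoprojection Y)
  calc ∫⁻ z, ENNReal.ofReal (z ⬝ᵥ (rowCoprojection Y).mulVec z)⁻¹ ∂(stdVector κ)
      = ∫⁻ z, (∫⁻ s in Set.Ioi (1 : ℝ), ENNReal.ofReal (1 / 2) * ENNReal.ofReal
          (Real.exp (-((s - 1) * (z ⬝ᵥ (rowCoprojection Y).mulVec z)) / 2))) ∂(stdVector κ) :=
        lintegral_congr_ae ((ae_rowCoprojection_pos hY (by omega)).mono fun z hz =>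
          (lintegral_Ioi_exp_eq_inv hz).symm)
    _ = ∫⁻ s in Set.Ioi (1 : ℝ), (∫⁻ z, ENNReal.ofReal (1 / 2) * ENNReal.ofReal
          (Real.exp (-((s - 1) * (z ⬝ᵥ (rowCoprojection Y).mulVec z)) / 2)) ∂(stdVector κ)) :=
        lintegral_lintegral_swap (Measurable.aemeasurable (by
          have : Measurable fun p : (κ → ℝ) × ℝ => p.1 ⬝ᵥ (rowCoprojection Y).mulVec p.1 :=
            hm.comp measurable_fst
          unfold Function.uncurry
          fun_prop))
    _ = ∫⁻ s in Set.Ioi (1 : ℝ), ENNReal.ofReal (1 / 2) *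
          ENNReal.ofReal (√(s ^ (Fintype.card κ - Fintype.card ι)))⁻¹ :=
        setLIntegral_congr_fun measurableSet_Ioi fun s hs => by
          rw [lintegral_const_mul _ (by fun_prop),
            lintegral_exp_neg_rowCoprojection hY (by omega) (le_of_lt hs)]
    _ = ENNReal.ofReal ((Fintype.card κ : ℝ) - Fintype.card ι - 2)⁻¹ := by
        rw [lintegral_Ioi_inv_sqrt_pow (by omega), Nat.cast_sub (by omega)]

end Residual

/-! ### Invertibility and mean inverse of a standard Wishart matrix. -/

section Wishart

variable {κ : Type*} [Fintype κ] [DecidableEq κ]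

/-- Induction on the number of rows: for almost all values of the other rows, the new one almost
surely has a nonzero residual, and the determinant is the product from `det_gram_eq`. -/
theorem ae_det_gram_ne_zero_fin {c : ℕ} (hc : c ≤ Fintype.card κ) :
    ∀ᵐ Z ∂(stdRows (Fin c) κ), (gram Z).det ≠ 0 := by
  induction c with
  | zero => simp
  | succ c ih =>
    have hmp := measurePreserving_piFinSuccAbove (fun _ : Fin (c + 1) => stdVector κ) 0
    have hprod : ∀ᵐ p ∂((stdVector κ).prod (stdRows (Fin c) κ)),
        (gram ((MeasurableEquiv.piFinSuccAbove (fun _ => κ → ℝ) 0).symm p)).det ≠ 0 := by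
      have hms : MeasurableSet {p | (gram
          ((MeasurableEquiv.piFinSuccAbove (fun _ : Fin (c + 1) => κ → ℝ) 0).symm p)).det ≠ 0} :=
        (measurable_det_gram.comp (MeasurableEquiv.measurable _))
          (measurableSet_singleton 0).compl
      rw [Measure.ae_prod_iff_ae_ae hms]
      refine (Measure.ae_ae_comm hms).2 ?_
      filter_upwards [ih (by omega)] with Y hY
      filter_upwards [ae_rowCoprojection_pos hY (by simpa using hc)] with z hz
      rw [det_gram_eq 0 _ hY]
      exact mul_ne_zero hY hz.ne'
    simpa only [MeasurableEquiv.symm_apply_apply] using hmp.quasiMeasurePreserving.ae hprod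

/-- Given the other `c - 1` rows, the entry is the reciprocal of a chi-square variable with `d =
card κ - c + 1` degrees of freedom. Its mean `(d - 2)⁻¹` does not depend on those rows. The
condition `d ≥ 3` is the source of the bound `n ≥ cₖ + 2`, and `d - 2` that of the coefficients in
the estimator. -/
theorem lintegral_gram_inv_apply_self_fin {c : ℕ} (hc : c + 2 ≤ Fintype.card κ) (i : Fin c) :
    ∫⁻ Z, ENNReal.ofReal ((gram Z)⁻¹ i i) ∂(stdRows (Fin c) κ) =
      ENNReal.ofReal ((Fintype.card κ : ℝ) - c - 1)⁻¹ := by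
  obtain _ | c := c
  · exact i.elim0
  have hmp := measurePreserving_piFinSuccAbove (fun _ : Fin (c + 1) => stdVector κ) i
  have hm : Measurable fun Z : Fin (c + 1) → κ → ℝ => ENNReal.ofReal ((gram Z)⁻¹ i i) :=
    (measurable_inv_apply_of_measurable measurable_gram_apply i i).ennreal_ofReal
  rw [← hmp.symm.lintegral_comp hm, lintegral_prod_symm _ (by
    exact (hm.comp (MeasurableEquiv.measurable _)).aemeasurable)]
  calc _ = ∫⁻ _, ENNReal.ofReal ((Fintype.card κ : ℝ) - (c + 1 : ℕ) - 1)⁻¹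
        ∂(stdRows (Fin c) κ) := by
        refine lintegral_congr_ae ?_
        filter_upwards [ae_det_gram_ne_zero_fin (κ := κ) (c := c) (by omega)] with Y hY
        have : ∀ z : κ → ℝ, (gram ((MeasurableEquiv.piFinSuccAbove
            (fun _ : Fin (c + 1) => κ → ℝ) i).symm (z, Y)))⁻¹ i i =
            (z ⬝ᵥ (rowCoprojection Y).mulVec z)⁻¹ := fun z => by
          rw [gram_inv_apply_self]
          · simp
          · simpa using hY
        simp_rw [this]
        rw [lintegral_inv_rowCoprojection hY (by simpa using hc)]
        congr 2
        push_cast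
        rw [Fintype.card_fin]
        ring
    _ = _ := by simp

theorem measurePreserving_comp_equiv_stdRows {ι ι' κ : Type*} [Fintype ι] [Fintype ι']
    [Fintype κ] (e : ι ≃ ι') :
    MeasurePreserving (fun (Z : ι → κ → ℝ) i => Z (e.symm i)) (stdRows ι κ) (stdRows ι' κ) := by
  have := measurePreserving_piCongrLeft (fun _ : ι' => stdVector κ) e
  convert this using 1
  ext Z i k
  obtain ⟨i, rfl⟩ := e.surjective i
  simp [MeasurableEquiv.piCongrLeft]

theorem gram_comp_equiv {ι ι' κ : Type*} [Fintype κ] (e : ι' → ι) (Z : ι → κ → ℝ) :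
    (gram fun i => Z (e i)) = (gram Z).submatrix e e := by
  ext i j
  simp [gram, Matrix.mul_apply]

variable {ι : Type*} [Fintype ι] [DecidableEq ι]

theorem ae_det_gram_ne_zero (hc : Fintype.card ι ≤ Fintype.card κ) :
    ∀ᵐ Z ∂(stdRows ι κ), (gram Z).det ≠ 0 := by
  let e := Fintype.equivFin ι
  filter_upwards [(measurePreserving_comp_equiv_stdRows (κ := κ) e).quasiMeasurePreserving.ae
    (ae_det_gram_ne_zero_fin hc)] with Z hZ
  rwa [gram_comp_equiv, Matrix.det_submatrix_equiv_self] at hZ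

theorem lintegral_gram_inv_apply_self (hc : Fintype.card ι + 2 ≤ Fintype.card κ) (i : ι) :
    ∫⁻ Z, ENNReal.ofReal ((gram Z)⁻¹ i i) ∂(stdRows ι κ) =
      ENNReal.ofReal ((Fintype.card κ : ℝ) - Fintype.card ι - 1)⁻¹ := by
  let e := Fintype.equivFin ι
  rw [← lintegral_gram_inv_apply_self_fin hc (e i),
    ← (measurePreserving_comp_equiv_stdRows (κ := κ) e).lintegral_comp
      (measurable_inv_apply_of_measurable measurable_gram_apply _ _).ennreal_ofReal]
  congr 1 with Z
  rw [gram_comp_equiv e.symm Z, Matrix.inv_submatrix_equiv]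
  simp

theorem gram_inv_apply_self_nonneg {ι κ : Type*} [Fintype ι] [DecidableEq ι] [Fintype κ]
    (Z : ι → κ → ℝ) (i : ι) : 0 ≤ (gram Z)⁻¹ i i :=
  (posSemidef_gram Z).inv.diag_nonneg

theorem integrable_gram_inv_apply_self (hc : Fintype.card ι + 2 ≤ Fintype.card κ) (i : ι) :
    Integrable (fun Z => (gram Z)⁻¹ i i) (stdRows ι κ) := by
  refine ⟨(measurable_inv_apply_of_measurable measurable_gram_apply i i).aestronglyMeasurable, ?_⟩
  rw [hasFiniteIntegral_iff_ofReal (.of_forall fun Z => gram_inv_apply_self_nonneg Z i),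
    lintegral_gram_inv_apply_self hc]
  exact ENNReal.ofReal_lt_top

/-- Evaluate the form at the sum and difference of two unit vectors. The bound passes integrability
from the diagonal of the inverse to its other entries. -/
theorem abs_apply_le_of_posSemidef {M : Matrix ι ι ℝ} (hM : M.PosSemidef) (i j : ι) :
    |M i j| ≤ (M i i + M j j) / 2 := by
  have hs : M j i = M i j := by simpa using hM.isHermitian.apply i j
  have h1 := hM.dotProduct_mulVec_nonneg (Pi.single i 1 + Pi.single j 1)
  have h2 := hM.dotProduct_mulVec_nonneg (Pi.single i 1 - Pi.single j 1)
  simp [Matrix.mulVec_add, Matrix.mulVec_sub, add_dotProduct, sub_dotProduct] at h1 h2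
  rw [abs_le]
  constructor <;> linarith

theorem integrable_gram_inv_apply (hc : Fintype.card ι + 2 ≤ Fintype.card κ) (i j : ι) :
    Integrable (fun Z => (gram Z)⁻¹ i j) (stdRows ι κ) := by
  refine (((integrable_gram_inv_apply_self hc i).add
    (integrable_gram_inv_apply_self hc j)).div_const 2).mono'
    (measurable_inv_apply_of_measurable measurable_gram_apply i j).aestronglyMeasurable
    (.of_forall fun Z => ?_)
  exact abs_apply_le_of_posSemidef (posSemidef_gram Z).inv i j

theorem measurePreserving_neg_stdVector (κ : Type*) [Fintype κ] :
    MeasurePreserving (fun z : κ → ℝ => -z) (stdVector κ) (stdVector κ) :=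
  measurePreserving_pi _ _ fun _ => ⟨measurable_neg,
    (gaussianReal_map_neg (μ := 0) (v := 1)).trans (by rw [neg_zero])⟩

theorem gram_smul_rows {ι κ : Type*} [Fintype ι] [DecidableEq ι] [Fintype κ] (ε : ι → ℝ) (Z : ι → κ → ℝ) :
    (gram fun i => ε i • Z i) = Matrix.diagonal ε * gram Z * Matrix.diagonal ε := by
  ext i j
  rw [Matrix.mul_diagonal, Matrix.diagonal_mul]
  simp only [gram, Matrix.mul_apply, Matrix.of_apply, Matrix.transpose_apply, Pi.smul_apply,
    smul_eq_mul, Finset.mul_sum, Finset.sum_mul]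
  exact Finset.sum_congr rfl fun k _ => by ring

/-- Off-diagonal entries have mean zero, because the sign of a row can be reversed. -/
theorem integral_gram_inv_apply_of_ne {ι κ : Type*} [Fintype ι] [DecidableEq ι] [Fintype κ]
    {i j : ι} (hij : i ≠ j) :
    ∫ Z, (gram Z)⁻¹ i j ∂(stdRows ι κ) = 0 := by
  let ε : ι → ℝ := fun k => if k = i then -1 else 1
  have hε : ∀ k, ε k * ε k = 1 := fun k => by
    by_cases h : k = i <;> simp [ε, h]
  have hD : (Matrix.diagonal ε)⁻¹ = Matrix.diagonal ε := Matrix.inv_eq_right_inv (by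
    rw [Matrix.diagonal_mul_diagonal]; simp [hε])
  have hmp : MeasurePreserving (fun (Z : ι → κ → ℝ) k => ε k • Z k) (stdRows ι κ)
      (stdRows ι κ) := by
    refine measurePreserving_pi _ _ fun k => ?_
    change MeasurePreserving (fun z : κ → ℝ => ε k • z) _ _
    by_cases h : k = i
    · have : (fun z : κ → ℝ => ε k • z) = fun z => -z := by ext z; simp [ε, h]
      rw [this]
      exact measurePreserving_neg_stdVector κ
    · have : (fun z : κ → ℝ => ε k • z) = id := by ext z; simp [ε, h]
      rw [this]
      exact MeasurePreserving.id _
  have hm := measurable_inv_apply_of_measurable (measurable_gram_apply (ι := ι) (κ := κ)) i j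
  have h : ∫ Z, (gram Z)⁻¹ i j ∂(stdRows ι κ) = -∫ Z, (gram Z)⁻¹ i j ∂(stdRows ι κ) := by
    conv_lhs => rw [← hmp.map_eq]
    rw [integral_map hmp.measurable.aemeasurable hm.aestronglyMeasurable, ← integral_neg]
    congr 1 with Z
    rw [gram_smul_rows, Matrix.mul_inv_rev, Matrix.mul_inv_rev, hD, ← Matrix.mul_assoc,
      Matrix.mul_diagonal, Matrix.diagonal_mul]
    simp [ε, hij.symm]
  linarith

/-- The mean of a standard inverse Wishart matrix. -/
theorem integral_gram_inv_apply (hc : Fintype.card ι + 2 ≤ Fintype.card κ) (i j : ι) :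
    ∫ Z, (gram Z)⁻¹ i j ∂(stdRows ι κ) =
      ((Fintype.card κ : ℝ) - Fintype.card ι - 1)⁻¹ * (1 : Matrix ι ι ℝ) i j := by
  rcases eq_or_ne i j with rfl | hij
  · have hc' : (Fintype.card ι : ℝ) + 2 ≤ Fintype.card κ := by exact_mod_cast hc
    rw [integral_eq_lintegral_of_nonneg_ae (.of_forall fun Z => gram_inv_apply_self_nonneg Z i)
      (measurable_inv_apply_of_measurable measurable_gram_apply i i).aestronglyMeasurable,
      lintegral_gram_inv_apply_self hc, ENNReal.toReal_ofReal (inv_nonneg.2 (by linarith))]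
    simp
  · rw [integral_gram_inv_apply_of_ne hij, Matrix.one_apply_ne hij, mul_zero]

end Wishart

/-! ### From standard arrays to blocks of a Gaussian sample. -/

/-- Both sides are curryings of one independent array. A sample is indexed by observations first, a
Gram matrix by nodes first. -/
theorem measurePreserving_swap_stdRows (ι κ : Type*) [Fintype ι] [Fintype κ] :
    MeasurePreserving (fun (z : κ → ι → ℝ) i t => z t i) (stdRows κ ι) (stdRows ι κ) := by
  have h := Measure.infinitePi_map_curry (fun (_ : κ) (_ : ι) => gaussianReal 0 1)
  have h' := Measure.infinitePi_map_curry (fun (_ : ι) (_ : κ) => gaussianReal 0 1)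
  simp only [Measure.infinitePi_eq_pi] at h h'
  have hs := measurePreserving_piCongrLeft (fun _ : ι × κ => gaussianReal 0 1) (Equiv.prodComm κ ι)
  refine ⟨by fun_prop, ?_⟩
  rw [stdRows, stdRows, ← h, ← h', ← hs.map_eq, Measure.map_map (by fun_prop) (by fun_prop),
    Measure.map_map (by fun_prop) (by fun_prop)]
  congr 1

section Marginal

variable {V ι : Type*} [Fintype V] [DecidableEq V] [Fintype ι] [DecidableEq ι]

/-- Both laws are Gaussian, so comparing means and covariances suffices. -/
theorem map_comp_multivariateGaussian {S : Matrix V V ℝ} (hS : S.PosSemidef) (e : ι → V) :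
    (multivariateGaussian 0 S).map
      (fun x : EuclideanSpace ℝ V => (WithLp.toLp 2 fun i => x (e i) : EuclideanSpace ℝ ι)) =
      multivariateGaussian 0 (S.submatrix e e) := by
  let r : EuclideanSpace ℝ V →L[ℝ] EuclideanSpace ℝ ι := LinearMap.toContinuousLinearMap
    { toFun := fun x => WithLp.toLp 2 fun i => x (e i)
      map_add' := fun x y => rfl
      map_smul' := fun a x => rfl }
  change (multivariateGaussian 0 S).map r = _
  apply IsGaussian.ext
  · simp only [id_eq, integral_id_multivariateGaussian]
    rw [ContinuousLinearMap.integral_id_map, integral_id_multivariateGaussian, map_zero]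
    exact IsGaussian.integrable_id
  rw [← ContinuousLinearMap.toBilinForm_inj]
  refine LinearMap.BilinForm.ext_basis (EuclideanSpace.basisFun ι ℝ).toBasis fun i j ↦ ?_
  rw [ContinuousLinearMap.toBilinForm_apply, ContinuousLinearMap.toBilinForm_apply,
    covarianceBilin_apply_eq_cov, covariance_map]
  · have (i : ι) : (fun u ↦ inner ℝ ((EuclideanSpace.basisFun ι ℝ).toBasis i) u) ∘
        r = fun u ↦ u (e i) := by
      ext u
      simp only [Function.comp_apply, OrthonormalBasis.coe_toBasis,
        EuclideanSpace.basisFun_inner]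
      rfl
    simp_rw [this, covariance_eval_multivariateGaussian hS,
      covarianceBilin_multivariateGaussian (hS.submatrix _)]
    simp
  any_goals exact Measurable.aestronglyMeasurable (by fun_prop)
  · fun_prop
  · exact IsGaussian.memLp_two_id

open scoped MatrixOrder in
/-- The coordinates of a Gaussian vector are a linear image of a standard Gaussian vector. -/
theorem exists_map_comp_multivariateGaussian {S : Matrix V V ℝ} (hS : S.PosSemidef) (e : ι → V) :
    ∃ B : Matrix ι ι ℝ, B * B.transpose = S.submatrix e e ∧
      (multivariateGaussian 0 S).map (fun x i => x (e i)) =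
        (stdVector ι).map fun z => B.mulVec z := by
  have hSe : (S.submatrix e e).PosSemidef := hS.submatrix e
  refine ⟨CFC.sqrt (S.submatrix e e), ?_, ?_⟩
  · have hT : (CFC.sqrt (S.submatrix e e)).transpose = CFC.sqrt (S.submatrix e e) :=
      (CFC.sqrt_nonneg (S.submatrix e e)).isSelfAdjoint.star_eq
    rw [hT, CFC.sqrt_mul_sqrt_self _ hSe.nonneg]
  · have h := congrArg (Measure.map (WithLp.ofLp (p := 2) (V := ι → ℝ)))
      (map_comp_multivariateGaussian hS e)
    have hdef : multivariateGaussian 0 (S.submatrix e e) = (stdGaussian (EuclideanSpace ℝ ι)).map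
      fun x => 0 + Matrix.toEuclideanCLM (𝕜 := ℝ) (CFC.sqrt (S.submatrix e e)) x := rfl
    rw [hdef, ← map_pi_eq_stdGaussian, Measure.map_map (by fun_prop) (by fun_prop),
      Measure.map_map (by fun_prop) (by fun_prop),
      Measure.map_map (by fun_prop) (by fun_prop)] at h
    refine h.trans ?_
    congr 1
    ext z i
    simp

/-- With `gram_mul`, this presents the sample covariance of a block as `B * gram Z * B.transpose`
with `Z` standard. -/
theorem exists_map_pi_multivariateGaussian {S : Matrix V V ℝ} (hS : S.PosSemidef) (e : ι → V)
    (n : ℕ) : ∃ B : Matrix ι ι ℝ, B * B.transpose = S.submatrix e e ∧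
      (Measure.pi fun _ : Fin n => multivariateGaussian 0 S).map (fun x i t => x t (e i)) =
        (stdRows ι (Fin n)).map fun Z i t => (B * Matrix.of Z) i t := by
  obtain ⟨B, hB, h⟩ := exists_map_comp_multivariateGaussian hS e
  have hBm : Measurable fun z : ι → ℝ => B.mulVec z := by
    unfold Matrix.mulVec dotProduct; fun_prop
  refine ⟨B, hB, ?_⟩
  have hrm : Measurable fun (x : EuclideanSpace ℝ V) i => x (e i) := by fun_prop
  have : IsProbabilityMeasure
      ((multivariateGaussian 0 S).map fun (x : EuclideanSpace ℝ V) i => x (e i)) :=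
    Measure.isProbabilityMeasure_map hrm.aemeasurable
  have : IsProbabilityMeasure ((stdVector ι).map fun z => B.mulVec z) :=
    Measure.isProbabilityMeasure_map hBm.aemeasurable
  have h1 := Measure.pi_map_pi (ι := Fin n) (μ := fun _ => multivariateGaussian 0 S)
    (f := fun _ (x : EuclideanSpace ℝ V) i => x (e i)) fun _ => hrm.aemeasurable
  have h2 := Measure.pi_map_pi (ι := Fin n) (μ := fun _ => stdVector ι)
    (f := fun _ z => B.mulVec z) fun _ => hBm.aemeasurable
  have h3 := congrArg (Measure.map fun (z : Fin n → ι → ℝ) i t => z t i)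
    (h1.trans ((congrArg (fun μ => Measure.pi fun _ => μ) h).trans h2.symm))
  have hBm' : Measurable fun (Z : ι → Fin n → ℝ) i t => (B * Matrix.of Z) i t := by
    simp only [Matrix.mul_apply, Matrix.of_apply]; fun_prop
  rw [Measure.map_map (by fun_prop) (by fun_prop), Measure.map_map (by fun_prop) (by fun_prop)]
    at h3
  rw [← (measurePreserving_swap_stdRows ι (Fin n)).map_eq,
    Measure.map_map hBm' (by fun_prop)]
  exact h3

theorem gram_mul {ι κ : Type*} [Fintype ι] [Fintype κ] (B : Matrix ι ι ℝ) (Z : ι → κ → ℝ) :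
    (gram fun i t => (B * Matrix.of Z) i t) = B * gram Z * B.transpose := by
  have : (Matrix.of fun i t => (B * Matrix.of Z) i t) = B * Matrix.of Z := rfl
  rw [gram, this, Matrix.transpose_mul, gram]
  simp only [Matrix.mul_assoc]

/-- The Gram matrix of the rows indexed by `ι` of a sample, i.e. its (not normalized) sample
covariance. -/
def blockGram (e : ι → V) {n : ℕ} (x : Fin n → EuclideanSpace ℝ V) : Matrix ι ι ℝ :=
  gram fun i t => x t (e i)

theorem ae_det_blockGram_ne_zero {S : Matrix V V ℝ} (hS : S.PosDef) {e : ι → V}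
    (he : Function.Injective e) {n : ℕ} (hn : Fintype.card ι ≤ n) :
    ∀ᵐ x ∂(Measure.pi fun _ : Fin n => multivariateGaussian 0 S), (blockGram e x).det ≠ 0 := by
  obtain ⟨B, hB, h⟩ := exists_map_pi_multivariateGaussian hS.posSemidef e n
  have hBm : Measurable fun (Z : ι → Fin n → ℝ) i t => (B * Matrix.of Z) i t := by
    simp only [Matrix.mul_apply, Matrix.of_apply]; fun_prop
  have hBd : B.det ≠ 0 := fun h0 => by
    have := (hS.submatrix he).det_pos
    rw [← hB, Matrix.det_mul, h0, zero_mul] at this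
    exact this.false
  have hms : MeasurableSet {Z : ι → Fin n → ℝ | (gram Z).det ≠ 0} :=
    measurable_det_gram (measurableSet_singleton 0).compl
  have key : ∀ᵐ Z ∂((Measure.pi fun _ : Fin n => multivariateGaussian 0 S).map
      (fun x i t => x t (e i))), (gram Z).det ≠ 0 := by
    rw [h, ae_map_iff hBm.aemeasurable hms]
    filter_upwards [ae_det_gram_ne_zero (ι := ι) (κ := Fin n) (by simpa using hn)] with Z hZ
    rw [gram_mul, Matrix.det_mul, Matrix.det_mul, Matrix.det_transpose]
    exact mul_ne_zero (mul_ne_zero hBd hZ) hBd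
  exact ae_of_ae_map (f := fun (x : Fin n → EuclideanSpace ℝ V) i t => x t (e i))
    (Measurable.aemeasurable (by fun_prop)) key

/-- The mean of an inverse Wishart matrix. -/
theorem integral_blockGram_inv {S : Matrix V V ℝ} (hS : S.PosSemidef) (e : ι → V) {n : ℕ} (hn : Fintype.card ι + 2 ≤ n) (i j : ι) :
    Integrable (fun x => (blockGram e x)⁻¹ i j)
      (Measure.pi fun _ : Fin n => multivariateGaussian 0 S) ∧
    ((n : ℝ) - Fintype.card ι - 1) * ∫ x, (blockGram e x)⁻¹ i j
      ∂(Measure.pi fun _ : Fin n => multivariateGaussian 0 S) = (S.submatrix e e)⁻¹ i j := by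
  obtain ⟨B, hB, h⟩ := exists_map_pi_multivariateGaussian hS e n
  have hBm : Measurable fun (Z : ι → Fin n → ℝ) i t => (B * Matrix.of Z) i t := by
    simp only [Matrix.mul_apply, Matrix.of_apply]; fun_prop
  have hm := measurable_inv_apply_of_measurable (measurable_gram_apply (ι := ι) (κ := Fin n)) i j
  have hrm : Measurable fun (x : Fin n → EuclideanSpace ℝ V) i t => x t (e i) := by fun_prop
  have hc : Fintype.card ι + 2 ≤ Fintype.card (Fin n) := by simpa using hn
  have hn' : (Fintype.card ι : ℝ) + 2 ≤ n := by exact_mod_cast hn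
  -- `Matrix.mul_inv_rev` holds for singular matrices too, whose inverse is `0` by convention, so
  -- neither `B` nor `gram Z` has to be invertible here.
  have hinv : ∀ Z : ι → Fin n → ℝ, (gram fun i t => (B * Matrix.of Z) i t)⁻¹ i j =
      ∑ k, (∑ l, B.transpose⁻¹ i l * (gram Z)⁻¹ l k) * B⁻¹ k j := fun Z => by
    rw [gram_mul, Matrix.mul_inv_rev, Matrix.mul_inv_rev, ← Matrix.mul_assoc, Matrix.mul_apply]
    simp only [Matrix.mul_apply]
  have hint : ∀ k l, Integrable (fun Z => B.transpose⁻¹ i l * (gram Z)⁻¹ l k)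
      (stdRows ι (Fin n)) := fun k l => (integrable_gram_inv_apply hc l k).const_mul _
  have hint' : ∀ k, Integrable (fun Z => (∑ l, B.transpose⁻¹ i l * (gram Z)⁻¹ l k) * B⁻¹ k j)
      (stdRows ι (Fin n)) := fun k => (integrable_finsetSum _ fun l _ => hint k l).mul_const _
  constructor
  · have : Integrable (fun Z => (gram Z)⁻¹ i j)
        ((Measure.pi fun _ : Fin n => multivariateGaussian 0 S).map
          (fun x i t => x t (e i))) := by
      rw [h, integrable_map_measure hm.aestronglyMeasurable hBm.aemeasurable]
      simp only [Function.comp_def, hinv]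
      exact integrable_finsetSum _ fun k _ => hint' k
    exact (integrable_map_measure hm.aestronglyMeasurable hrm.aemeasurable).1 this
  · have h1 := integral_map (μ := Measure.pi fun _ : Fin n => multivariateGaussian 0 S)
      hrm.aemeasurable hm.aestronglyMeasurable
    rw [h, integral_map hBm.aemeasurable hm.aestronglyMeasurable] at h1
    simp only [blockGram]
    rw [← h1]
    simp only [hinv]
    rw [integral_finsetSum _ fun k _ => hint' k]
    simp only [integral_mul_const]
    simp_rw [integral_finsetSum _ fun l _ => hint _ l, integral_const_mul,
      integral_gram_inv_apply hc]
    rw [← hB, Matrix.mul_inv_rev, Matrix.mul_apply, Finset.mul_sum]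
    refine Finset.sum_congr rfl fun k _ => ?_
    have hne : (n : ℝ) - Fintype.card ι - 1 ≠ 0 := by linarith
    simp [Matrix.one_apply]
    field_simp

end Marginal

/-! ### Inverses of covariance blocks under conditional independence. -/

section LocalInverse

variable {V : Type*} [DecidableEq V]

/-- The inverse of the block of `S` on `A`, filled in with zeros. -/
noncomputable def localInv (S : Matrix V V ℝ) (A : Finset V) : Matrix V V ℝ :=
  zeroFill A (S.submatrix ((↑) : A → V) (↑))⁻¹

theorem localInv_apply_of_notMem_left (S : Matrix V V ℝ) {A : Finset V} {i : V} (hi : i ∉ A)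
    (j : V) : localInv S A i j = 0 :=
  dif_neg fun h => hi h.1

theorem localInv_apply_of_notMem_right (S : Matrix V V ℝ) {A : Finset V} (i : V) {j : V}
    (hj : j ∉ A) : localInv S A i j = 0 :=
  dif_neg fun h => hj h.2

theorem localInv_symm {S : Matrix V V ℝ} (hS : S.PosDef) (A : Finset V) (i j : V) :
    localInv S A i j = localInv S A j i := by
  by_cases hi : i ∈ A
  · by_cases hj : j ∈ A
    · have h : (S.submatrix ((↑) : A → V) (↑))⁻¹.IsHermitian :=
        (hS.submatrix Subtype.val_injective).inv.isHermitian
      simpa [localInv, zeroFill, hi, hj] using (h.apply ⟨i, hi⟩ ⟨j, hj⟩).symm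
    · rw [localInv_apply_of_notMem_right S i hj, localInv_apply_of_notMem_left S hj]
  · rw [localInv_apply_of_notMem_left S hi, localInv_apply_of_notMem_right S j hi]

variable [Fintype V]

/-- At each index `v` or `S.mulVec v` vanishes, so the form of `S` at `v` is zero. -/
theorem eq_zero_of_mulVec_eq_zero_on {S : Matrix V V ℝ} (hS : S.PosDef) {A : Finset V} {v : V → ℝ}
    (hv : ∀ i ∉ A, v i = 0) (h : ∀ i ∈ A, S.mulVec v i = 0) : v = 0 := by
  by_contra hne
  have := hS.dotProduct_mulVec_pos hne
  rw [star_trivial, dotProduct, Finset.sum_eq_zero fun i _ => ?_] at this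
  · exact this.false
  · by_cases hi : i ∈ A
    · rw [h i hi, mul_zero]
    · rw [hv i hi, zero_mul]

theorem mulVec_localInv_col {S : Matrix V V ℝ} (hS : S.PosDef) {A : Finset V} {i j : V}
    (hi : i ∈ A) (hj : j ∈ A) :
    S.mulVec (fun k => localInv S A k j) i = (1 : Matrix V V ℝ) i j := by
  have hu : IsUnit (S.submatrix ((↑) : A → V) (↑)).det :=
    (Matrix.isUnit_iff_isUnit_det _).1 (hS.submatrix Subtype.val_injective).isUnit
  have h := congrFun (congrFun (Matrix.mul_nonsing_inv _ hu) ⟨i, hi⟩) ⟨j, hj⟩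
  rw [Matrix.mul_apply] at h
  have h1 : (1 : Matrix A A ℝ) ⟨i, hi⟩ ⟨j, hj⟩ = (1 : Matrix V V ℝ) i j := by
    simp [Matrix.one_apply]
  rw [← h1, ← h, Matrix.mulVec, dotProduct, ← Finset.sum_subset A.subset_univ fun k _ hk => by
    rw [localInv_apply_of_notMem_left S hk, mul_zero], ← Finset.sum_coe_sort]
  refine Finset.sum_congr rfl fun k _ => ?_
  simp [localInv, zeroFill, hj]

/-- A column of a local inverse is determined by its support and the equations on `A`; this is how
local inverses on different sets are compared. -/
theorem localInv_col_eq {S : Matrix V V ℝ} (hS : S.PosDef) {A : Finset V} {j : V} (hj : j ∈ A)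
    {v : V → ℝ} (hv : ∀ i ∉ A, v i = 0)
    (h : ∀ i ∈ A, S.mulVec v i = (1 : Matrix V V ℝ) i j) (i : V) : v i = localInv S A i j := by
  have := eq_zero_of_mulVec_eq_zero_on hS (A := A) (v := v - fun k => localInv S A k j)
    (fun i hi => by
      rw [Pi.sub_apply, hv i hi, localInv_apply_of_notMem_left S hi, sub_zero])
    (fun i hi => by
      rw [Matrix.mulVec_sub, Pi.sub_apply, h i hi, mulVec_localInv_col hS hi hj, sub_self])
  simpa [sub_eq_zero] using congrFun this i

theorem localInv_univ {K : Matrix V V ℝ} (hK : K.PosDef) : localInv K⁻¹ Finset.univ = K := by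
  ext i j
  refine (localInv_col_eq hK.inv (Finset.mem_univ j) (v := fun k => K k j) (by simp)
    (fun k _ => ?_) i).symm
  have hu : IsUnit K.det := (Matrix.isUnit_iff_isUnit_det _).1 hK.isUnit
  rw [← Matrix.nonsing_inv_mul _ hu, Matrix.mul_apply]
  rfl

/-- If the nodes in `a` and `b` are conditionally independent given those in `c`, then the inverse
of the block on `a ∪ c ∪ b` is assembled from those of the blocks on `a ∪ c`, `c ∪ b` and `c`. -/
theorem localInv_union_eq {S : Matrix V V ℝ} (hS : S.PosDef) {a c b : Finset V}
    (hac : Disjoint a c) (hcb : Disjoint c b) (hab : Disjoint a b)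
    (h : ∀ i ∈ a, ∀ j ∈ b, localInv S (a ∪ c ∪ b) i j = 0) :
    localInv S (a ∪ c ∪ b) = localInv S (a ∪ c) + localInv S (c ∪ b) - localInv S c := by
  -- A column at `j ∈ a` vanishes on `b`, so it is supported on `a ∪ c` and solves the equations
  -- there. The other two terms have no column at `j`.
  have left : ∀ i, ∀ j ∈ a, localInv S (a ∪ c ∪ b) i j =
      (localInv S (a ∪ c) + localInv S (c ∪ b) - localInv S c) i j := fun i j hj => by
    have hjc : j ∉ c := Finset.disjoint_left.1 hac hj
    have hjb : j ∉ b := Finset.disjoint_left.1 hab hj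
    rw [Matrix.sub_apply, Matrix.add_apply, localInv_apply_of_notMem_right S (A := c ∪ b) i
      (by simp [hjc, hjb]), localInv_apply_of_notMem_right S (A := c) i hjc, add_zero, sub_zero]
    refine localInv_col_eq hS (by simp [hj]) (v := fun k => localInv S (a ∪ c ∪ b) k j)
      (fun k hk => ?_) (fun k hk => mulVec_localInv_col hS ?_ ?_) i
    · by_cases hkb : k ∈ b
      · rw [localInv_symm hS, h j hj k hkb]
      · exact localInv_apply_of_notMem_left S (by simp_all) _
    · exact Finset.mem_union_left _ hk
    · simp [hj]
  have right : ∀ i, ∀ j ∈ b, localInv S (a ∪ c ∪ b) i j =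
      (localInv S (a ∪ c) + localInv S (c ∪ b) - localInv S c) i j := fun i j hj => by
    have hjc : j ∉ c := Finset.disjoint_right.1 hcb hj
    have hja : j ∉ a := Finset.disjoint_right.1 hab hj
    rw [Matrix.sub_apply, Matrix.add_apply, localInv_apply_of_notMem_right S (A := a ∪ c) i
      (by simp [hjc, hja]), localInv_apply_of_notMem_right S (A := c) i hjc, zero_add, sub_zero]
    refine localInv_col_eq hS (by simp [hj]) (v := fun k => localInv S (a ∪ c ∪ b) k j)
      (fun k hk => ?_) (fun k hk => mulVec_localInv_col hS ?_ ?_) i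
    · by_cases hka : k ∈ a
      · exact h k hka j hj
      · exact localInv_apply_of_notMem_left S (by simp_all) _
    · rw [Finset.union_assoc]; exact Finset.mem_union_right _ hk
    · simp [hj]
  have symm : ∀ i j, (localInv S (a ∪ c) + localInv S (c ∪ b) - localInv S c) i j =
      (localInv S (a ∪ c) + localInv S (c ∪ b) - localInv S c) j i := fun i j => by
    simp only [Matrix.sub_apply, Matrix.add_apply, localInv_symm hS _ i j]
  ext i j
  by_cases hja : j ∈ a
  · exact left i j hja
  by_cases hjb : j ∈ b
  · exact right i j hjb
  by_cases hjc : j ∈ c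
  -- For `j ∈ c`, symmetry and the previous cases make the difference of the columns vanish off `c`.
  -- On `c`, each of the four columns is mapped by `S` to the same unit vector, and these cancel.
  · have h0 := eq_zero_of_mulVec_eq_zero_on hS (A := c) (v := (fun k => localInv S (a ∪ c ∪ b) k j) -
      ((fun k => localInv S (a ∪ c) k j) + (fun k => localInv S (c ∪ b) k j) -
        fun k => localInv S c k j)) (fun k hk => ?_) (fun k hk => ?_)
    · have := congrFun h0 i
      simp only [Pi.sub_apply, Pi.add_apply, Pi.zero_apply, sub_eq_zero] at this
      simpa using this
    · simp only [Pi.sub_apply, Pi.add_apply, sub_eq_zero]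
      by_cases hka : k ∈ a
      · rw [localInv_symm hS, left j k hka, symm]; rfl
      · by_cases hkb : k ∈ b
        · rw [localInv_symm hS, right j k hkb, symm]; rfl
        · rw [localInv_apply_of_notMem_left S (by simp_all),
            localInv_apply_of_notMem_left S (by simp_all),
            localInv_apply_of_notMem_left S (by simp_all),
            localInv_apply_of_notMem_left S hk]
          simp
    · simp only [Matrix.mulVec_sub, Matrix.mulVec_add, Pi.sub_apply, Pi.add_apply]
      rw [mulVec_localInv_col hS (by simp [hk]) (by simp [hjc]),
        mulVec_localInv_col hS (by simp [hk]) (by simp [hjc]),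
        mulVec_localInv_col hS (by simp [hk]) (by simp [hjc]),
        mulVec_localInv_col hS hk hjc]
      ring
  · rw [localInv_apply_of_notMem_right S i (by simp_all), Matrix.sub_apply, Matrix.add_apply,
      localInv_apply_of_notMem_right S i (by simp_all),
      localInv_apply_of_notMem_right S i (by simp_all),
      localInv_apply_of_notMem_right S i hjc]
    simp

end LocalInverse

/-! ### Perfect orders, the zero pattern, and the decomposition of `K`. -/

section PerfectOrder

variable {V : Type*} [DecidableEq V] {G : SimpleGraph V} {m : ℕ} {C : Fin (m + 1) → Finset V}

theorem mem_history {j : Fin (m + 1)} {v : V} : v ∈ history C j ↔ ∃ i ≤ j, v ∈ C i := by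
  simp [history]

theorem history_zero : history C 0 = C 0 := by
  ext v
  simp [mem_history]

theorem history_succ (k : Fin m) :
    history C k.succ = history C k.castSucc ∪ C k.succ := by
  ext v
  simp only [mem_history, Finset.mem_union]
  constructor
  · rintro ⟨i, hi, hv⟩
    rcases hi.lt_or_eq with h | rfl
    · exact Or.inl ⟨i, Fin.le_castSucc_iff.2 h, hv⟩
    · exact Or.inr hv
  · rintro (⟨i, hi, hv⟩ | hv)
    · exact ⟨i, hi.trans (Fin.castSucc_lt_succ).le, hv⟩
    · exact ⟨_, le_rfl, hv⟩

theorem sdiff_sep_union_sep (k : Fin m) :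
    history C k.castSucc \ sep C k ∪ sep C k = history C k.castSucc :=
  Finset.sdiff_union_of_subset Finset.inter_subset_left

theorem sep_union_residual (k : Fin m) : sep C k ∪ residual C k = C k.succ := by
  ext v
  rw [sep, residual, history_succ]
  simp only [Finset.mem_union, Finset.mem_inter, Finset.mem_sdiff]
  tauto

/-- A one-edge path has only its endpoints, neither of which lies in `c`. -/
theorem IsDecomposition.not_adj {H a c b : Finset V} (h : IsDecomposition G H a c b) {u v : V}
    (hu : u ∈ a) (hv : v ∈ b) : ¬ G.Adj u v := fun hadj => by
  have hH := h.union_eq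
  obtain ⟨w, hw, hwc⟩ := h.separates u hu v hv hadj.toWalk (fun w hw => by
    rw [← hH]
    simp only [SimpleGraph.Adj.toWalk, SimpleGraph.Walk.support_cons,
      SimpleGraph.Walk.support_nil, List.mem_cons, List.not_mem_nil, or_false] at hw
    rcases hw with rfl | rfl <;> simp [hu, hv])
  simp only [SimpleGraph.Adj.toWalk, SimpleGraph.Walk.support_cons,
    SimpleGraph.Walk.support_nil, List.mem_cons, List.not_mem_nil, or_false] at hw
  rcases hw with rfl | rfl
  · exact Finset.disjoint_left.1 h.disjoint_left hu hwc
  · exact Finset.disjoint_left.1 h.disjoint_right hwc hv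

variable [Fintype V]

theorem IsPerfectCliqueOrder.exists_mem (hC : IsPerfectCliqueOrder G C) (v : V) :
    ∃ k, v ∈ C k := by
  obtain ⟨A, hA, hmax⟩ := Finite.exists_le_maximal
    (p := fun B : Finset V => G.IsClique (B : Set V)) (a := {v}) (by simp)
  obtain ⟨k, rfl⟩ := (hC.range_eq A).2 hmax
  exact ⟨k, hA (Finset.mem_singleton_self v)⟩

theorem IsPerfectCliqueOrder.history_last (hC : IsPerfectCliqueOrder G C) :
    history C (Fin.last m) = Finset.univ := by
  ext v
  obtain ⟨k, hk⟩ := hC.exists_mem v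
  simpa [mem_history] using ⟨k, Fin.le_last k, hk⟩

/-- The zeros which the model prescribes are those at the missing edges of `G`. -/
theorem IsPerfectCliqueOrder.mem_concentrationSet_iff (hC : IsPerfectCliqueOrder G C)
    {K : Matrix V V ℝ} : K ∈ concentrationSet C ↔
      K.PosDef ∧ ∀ i j, i ≠ j → ¬ G.Adj i j → K i j = 0 := by
  refine and_congr_right fun hK => ⟨fun h => ?_, fun h k i hi j hj => ?_⟩
  · have hsymm : ∀ i j, K j i = K i j := fun i j => by simpa using hK.isHermitian.apply i j
    have key : ∀ l : Fin (m + 1), ∀ i ∈ history C l, ∀ j ∈ history C l, i ≠ j → ¬ G.Adj i j →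
        K i j = 0 := by
      intro l
      induction l using Fin.induction with
      | zero =>
        intro i hi j hj hij hadj
        rw [history_zero] at hi hj
        exact absurd (hC.isClique 0 hi hj hij) hadj
      | succ k ih =>
        -- If `i` were in the separator, it would lie in the clique `C k.succ` together with `j` and
        -- be adjacent to it. So a new missing edge lies in a prescribed zero block.
        have half : ∀ i ∈ history C k.castSucc, ∀ j ∈ C k.succ, i ≠ j → ¬ G.Adj i j →
            K i j = 0 := fun i hi j hj hij hadj => by
          by_cases hj' : j ∈ history C k.castSucc
          · exact ih i hi j hj' hij hadj
          · refine h k i (Finset.mem_sdiff.2 ⟨hi, fun hs => ?_⟩) j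
              (Finset.mem_sdiff.2 ⟨by simp [history_succ, hj], hj'⟩)
            exact hadj (hC.isClique k.succ (Finset.mem_inter.1 hs).2 hj hij)
        intro i hi j hj hij hadj
        rw [history_succ, Finset.mem_union] at hi hj
        rcases hi with hi | hi <;> rcases hj with hj | hj
        · exact ih i hi j hj hij hadj
        · exact half i hi j hj hij hadj
        · rw [← hsymm]
          exact half j hj i hi hij.symm fun h => hadj h.symm
        · exact absurd (hC.isClique k.succ hi hj hij) hadj
    intro i j
    exact key (Fin.last m) i (by simp [hC.history_last]) j (by simp [hC.history_last])
  · have hd := hC.decomposition k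
    exact h i j (fun e => Finset.disjoint_left.1 hd.disjoint_outer hi (e ▸ hj))
      (IsDecomposition.not_adj hd hi hj)

/-- In the model, the concentration matrix is assembled from the inverses of the blocks of the
covariance matrix on the cliques and the separators. -/
theorem IsPerfectCliqueOrder.eq_sum_localInv (hC : IsPerfectCliqueOrder G C)
    {K : Matrix V V ℝ} (hK : K ∈ concentrationSet C) :
    ∑ k, localInv K⁻¹ (C k) - ∑ k, localInv K⁻¹ (sep C k) = K := by
  obtain ⟨hpd, hzero⟩ := hC.mem_concentrationSet_iff.1 hK
  have hS := hpd.inv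
  have step : ∀ k : Fin m,
      (∀ i j, i ≠ j → ¬ G.Adj i j → localInv K⁻¹ (history C k.succ) i j = 0) →
      localInv K⁻¹ (history C k.succ) = localInv K⁻¹ (history C k.castSucc) +
        localInv K⁻¹ (C k.succ) - localInv K⁻¹ (sep C k) := fun k hk => by
    have hd := hC.decomposition k
    have := localInv_union_eq hS hd.disjoint_left hd.disjoint_right hd.disjoint_outer
      fun i hi j hj => by
        rw [hd.union_eq]
        exact hk i j (fun e => Finset.disjoint_left.1 hd.disjoint_outer hi (e ▸ hj))
          (IsDecomposition.not_adj hd hi hj)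
    rwa [hd.union_eq, sdiff_sep_union_sep, sep_union_residual] at this
  have hvanish : ∀ {A : Finset V}, G.IsClique (A : Set V) → ∀ i j, i ≠ j → ¬ G.Adj i j →
      localInv K⁻¹ A i j = 0 := fun {A} hA i j hij hadj => by
    by_cases hi : i ∈ A
    · exact localInv_apply_of_notMem_right _ i fun hj => hadj (hA hi hj hij)
    · exact localInv_apply_of_notMem_left _ hi j
  -- Downward induction from the full node set, whose local inverse is `K`: the clique and separator
  -- terms vanish at missing edges, so the zero pattern passes to the preceding history.
  have pattern : ∀ l : Fin (m + 1), ∀ i j, i ≠ j → ¬ G.Adj i j →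
      localInv K⁻¹ (history C l) i j = 0 := by
    intro l
    induction l using Fin.reverseInduction with
    | last => rwa [hC.history_last, localInv_univ hpd]
    | cast k ih =>
      intro i j hij hadj
      have := congrFun (congrFun (step k ih) i) j
      rw [ih i j hij hadj, Matrix.sub_apply, Matrix.add_apply,
        hvanish (hC.isClique _) i j hij hadj, hvanish (hC.isClique_sep _) i j hij hadj] at this
      linarith
  -- Summed over `k`, the local inverses of the histories telescope, leaving `K` and the first
  -- clique.
  have hsum : ∑ k : Fin m, localInv K⁻¹ (history C k.succ) =
      ∑ k : Fin m, localInv K⁻¹ (history C k.castSucc) + ∑ k : Fin m, localInv K⁻¹ (C k.succ) -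
        ∑ k, localInv K⁻¹ (sep C k) := by
    rw [← Finset.sum_add_distrib, ← Finset.sum_sub_distrib]
    exact Finset.sum_congr rfl fun k _ => step k (pattern k.succ)
  have h1 := Fin.sum_univ_castSucc fun k => localInv K⁻¹ (history C k)
  rw [Fin.sum_univ_succ, hsum, history_zero, hC.history_last, localInv_univ hpd] at h1
  rw [Fin.sum_univ_succ]
  have h2 := congrArg (· - ∑ k : Fin m, localInv K⁻¹ (history C k.castSucc)) h1
  simp only [add_sub_cancel_left] at h2
  refine Eq.trans ?_ h2
  abel

end PerfectOrder

/-! ### Completeness of the incomplete sample covariance. -/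

section Completeness

variable {V : Type*} [Fintype V]

/-- By compactness of the unit sphere, positivity there survives small perturbations uniformly;
scaling extends it to all nonzero vectors. -/
theorem exists_posDef_add_smul {K N : Matrix V V ℝ} (hK : K.PosDef) (hN : N.IsHermitian) :
    ∃ ε > 0, ∀ t : ℝ, |t| < ε → (K + t • N).PosDef := by
  have hcont : Continuous fun p : ℝ × (V → ℝ) => p.2 ⬝ᵥ (K + p.1 • N).mulVec p.2 := by
    unfold Matrix.mulVec dotProduct
    simp only [Matrix.add_apply, Matrix.smul_apply]
    fun_prop
  have h := (isCompact_sphere (0 : V → ℝ) 1).eventually_forall_of_forall_eventually (x₀ := (0 : ℝ))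
    (P := fun t v => 0 < v ⬝ᵥ (K + t • N).mulVec v) fun v hv => by
      refine hcont.continuousAt.eventually (lt_mem_nhds ?_)
      have hne : v ≠ 0 := ne_zero_of_mem_unit_sphere (⟨v, hv⟩ : Metric.sphere (0 : V → ℝ) 1)
      simpa using hK.dotProduct_mulVec_pos hne
  obtain ⟨ε, hε, hball⟩ := Metric.eventually_nhds_iff.1 h
  refine ⟨ε, hε, fun t ht => Matrix.PosDef.of_dotProduct_mulVec_pos
    (hK.isHermitian.add (hN.smul (IsSelfAdjoint.all t))) fun v hv => ?_⟩
  have hpos := hball (y := t) (by simpa using ht) (‖v‖⁻¹ • v) (by simp [norm_smul, hv])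
  rw [Matrix.mulVec_smul, dotProduct_smul, smul_dotProduct, smul_smul, smul_eq_mul] at hpos
  have hn : 0 < ‖v‖⁻¹ * ‖v‖⁻¹ := by positivity
  rw [star_trivial]
  exact (pos_iff_pos_of_mul_pos hpos).1 hn

variable [DecidableEq V] {G : SimpleGraph V} {m : ℕ} {C : Fin (m + 1) → Finset V}

theorem measurable_incompleteCov {V : Type*} (G : SimpleGraph V) (n : ℕ) :
    Measurable fun x : Fin n → EuclideanSpace ℝ V => incompleteCov G x := by
  unfold incompleteCov sampleCov
  simp only [Matrix.of_apply]
  fun_prop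

instance isProbabilityMeasure_sampleLaw (n : ℕ) (K : Matrix V V ℝ) :
    IsProbabilityMeasure (sampleLaw n K) := by
  unfold sampleLaw; infer_instance

theorem dotProduct_mulVec_sum_single [Fintype (Position G)] (l : Position G → ℝ) (v : V → ℝ) :
    v ⬝ᵥ (∑ e : Position G, Matrix.single e.1.1 e.1.2 (l e)).mulVec v =
      ∑ e, l e * (v e.1.1 * v e.1.2) := by
  rw [Matrix.sum_mulVec, dotProduct_sum]
  refine Finset.sum_congr rfl fun e _ => ?_
  rw [Matrix.single_mulVec]
  simp [dotProduct, Function.update_apply]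
  ring

/-- A linear functional of the incomplete sample covariance is, up to the factor `-1/2`, a quadratic
form in the observations, with a symmetric matrix whose entries vanish at the missing edges. -/
theorem exists_isHermitian_sum_quadratic_eq (L : StrongDual ℝ (IncompleteMatrix G)) :
    ∃ N : Matrix V V ℝ, N.IsHermitian ∧ (∀ i j, i ≠ j → ¬ G.Adj i j → N i j = 0) ∧
      ∀ {n : ℕ} (x : Fin n → EuclideanSpace ℝ V),
        -(∑ t, (x t).ofLp ⬝ᵥ N.mulVec (x t).ofLp) / 2 = L (incompleteCov G x) := by
  classical
  have : Fintype (Position G) := Fintype.ofFinite _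
  let l : Position G → ℝ := fun e => L fun e' => if e = e' then 1 else 0
  let M : Matrix V V ℝ := ∑ e : Position G, Matrix.single e.1.1 e.1.2 (l e)
  have hM : ∀ i j, i ≠ j → ¬ G.Adj i j → M i j = 0 := fun i j hij hadj => by
    simp only [M]
    rw [Matrix.sum_apply]
    refine Finset.sum_eq_zero fun e _ => ?_
    rw [Matrix.single_apply, if_neg]
    rintro ⟨rfl, rfl⟩
    exact e.2.elim hij hadj
  -- `M` and its transpose have the same quadratic form, so symmetrizing doubles it; the factor `2`
  -- and the sign cancel the `-1/2` of the Gaussian exponent.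
  refine ⟨-(M + M.transpose), ?_, fun i j hij hadj => ?_, fun {n} x => ?_⟩
  · rw [Matrix.IsHermitian, Matrix.conjTranspose_eq_transpose_of_trivial, Matrix.transpose_neg,
      Matrix.transpose_add, Matrix.transpose_transpose, add_comm]
  · rw [Matrix.neg_apply, Matrix.add_apply, Matrix.transpose_apply, hM i j hij hadj,
      hM j i hij.symm fun h => hadj h.symm, add_zero, neg_zero]
  · have hq : ∀ v : V → ℝ, v ⬝ᵥ (-(M + M.transpose)).mulVec v =
        -2 * ∑ e, l e * (v e.1.1 * v e.1.2) := fun v => by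
      rw [← dotProduct_mulVec_sum_single, Matrix.neg_mulVec, Matrix.add_mulVec, dotProduct_neg,
        dotProduct_add, Matrix.mulVec_transpose, dotProduct_comm v (Matrix.vecMul v M),
        ← Matrix.dotProduct_mulVec]
      ring
    have hL := LinearMap.pi_apply_eq_sum_univ L.toLinearMap (incompleteCov G x)
    change L (incompleteCov G x) = ∑ e, incompleteCov G x e * l e at hL
    simp_rw [hq, hL, incompleteCov, sampleCov, Matrix.of_apply]
    rw [← Finset.mul_sum, Finset.sum_comm]
    simp_rw [← Finset.mul_sum]
    rw [neg_mul, neg_neg, mul_div_cancel_left₀ _ (two_ne_zero)]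
    exact Finset.sum_congr rfl fun e _ => mul_comm _ _

/-- The incomplete sample covariance is a complete statistic. -/
theorem IsPerfectCliqueOrder.ae_eq_zero_of_integral_eq_zero (hC : IsPerfectCliqueOrder G C)
    {n : ℕ} {g : IncompleteMatrix G → ℝ} (hg : Measurable g)
    (hint : ∀ K ∈ concentrationSet C, Integrable (fun x => g (incompleteCov G x)) (sampleLaw n K))
    (h0 : ∀ K ∈ concentrationSet C, ∫ x, g (incompleteCov G x) ∂(sampleLaw n K) = 0) :
    ∀ K ∈ concentrationSet C, ∀ᵐ x ∂(sampleLaw n K), g (incompleteCov G x) = 0 := by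
  classical
  intro K hK
  have : Fintype (Position G) := Fintype.ofFinite _
  obtain ⟨hKpd, hK0⟩ := hC.mem_concentrationSet_iff.1 hK
  have hm := measurable_incompleteCov G n
  have : IsProbabilityMeasure ((sampleLaw n K).map fun x => incompleteCov G x) :=
    Measure.isProbabilityMeasure_map hm.aemeasurable
  refine ae_of_ae_map (f := fun x => incompleteCov G x) hm.aemeasurable (p := fun S => g S = 0)
    (ae_eq_zero_of_integral_exp_mul_eq_zero hg fun L => ?_)
  obtain ⟨N, hN, hNzero, hNL⟩ := exists_isHermitian_sum_quadratic_eq L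
  obtain ⟨ε, hε, hpd⟩ := exists_posDef_add_smul hKpd hN
  refine ⟨ε, hε, fun t ht => ?_⟩
  have hmem : K + t • N ∈ concentrationSet C := hC.mem_concentrationSet_iff.2
    ⟨hpd t ht, fun i j hij hadj => by simp [hK0 i j hij hadj, hNzero i j hij hadj]⟩
  set a := (√(K + t • N).det / √K.det) ^ n
  have ha : 0 < a := by
    have := hKpd.det_pos
    have := (hpd t ht).det_pos
    positivity
  -- The shifted parameter is in the model, and its law is an exponential tilt of the one at `K`. So
  -- the zero mean there says that the Laplace transform of `g` vanishes at `t • L`.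
  have hlaw : sampleLaw n (K + t • N) = (sampleLaw n K).withDensity fun x =>
      ENNReal.ofReal (a * Real.exp (t * L (incompleteCov G x))) := by
    refine (pi_multivariateGaussian_eq_withDensity hKpd (hpd t ht) n).trans ?_
    congr 1 with x
    rw [← hNL x, add_sub_cancel_left]
    simp only [Matrix.smul_mulVec, dotProduct_smul, smul_eq_mul, ← Finset.mul_sum]
    congr 3
    ring
  have hdm : Measurable fun x : Fin n → EuclideanSpace ℝ V =>
      ENNReal.ofReal (a * Real.exp (t * L (incompleteCov G x))) := by
    have : Measurable fun x : Fin n → EuclideanSpace ℝ V => L (incompleteCov G x) :=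
      L.measurable.comp hm
    fun_prop
  have hfin : ∀ᵐ x ∂(sampleLaw n K),
      ENNReal.ofReal (a * Real.exp (t * L (incompleteCov G x))) < ⊤ := by simp
  have hpos : ∀ x : Fin n → EuclideanSpace ℝ V,
      0 ≤ a * Real.exp (t * L (incompleteCov G x)) := fun x => by positivity
  have hI := hint _ hmem
  have hZ := h0 _ hmem
  rw [hlaw, integrable_withDensity_iff_integrable_smul₀' hdm.aemeasurable hfin] at hI
  rw [hlaw, integral_withDensity_eq_integral_toReal_smul hdm hfin] at hZ
  simp only [ENNReal.toReal_ofReal (hpos _), smul_eq_mul, mul_assoc] at hI hZ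
  rw [integral_const_mul] at hZ
  have hgm : Measurable fun S : IncompleteMatrix G => Real.exp (t * L S) * g S := by
    have := L.measurable
    fun_prop
  rw [integrable_map_measure hgm.aestronglyMeasurable hm.aemeasurable,
    integral_map hm.aemeasurable hgm.aestronglyMeasurable]
  refine ⟨?_, (mul_eq_zero.1 hZ).resolve_left ha.ne'⟩
  simpa [Function.comp_def, ← mul_assoc, inv_mul_cancel₀ ha.ne'] using hI.const_mul a⁻¹

end Completeness

/-! ### Unbiasedness of the closed form and uniqueness. -/

section Estimation

variable {V : Type*} [Fintype V] [DecidableEq V] {G : SimpleGraph V}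

theorem measurable_zeroFill_apply {V α : Type*} [DecidableEq V] [MeasurableSpace α] {A : Finset V}
    {M : α → Matrix A A ℝ} (hM : ∀ i j, Measurable fun a => M a i j) (i j : V) :
    Measurable fun a => zeroFill A (M a) i j := by
  by_cases h : i ∈ A ∧ j ∈ A
  · simpa [zeroFill, h] using hM ⟨i, h.1⟩ ⟨j, h.2⟩
  · simp [zeroFill, h]

theorem block_incompleteCov {V : Type*} [DecidableEq V] {G : SimpleGraph V} {A : Finset V}
    (hA : G.IsClique (A : Set V)) {n : ℕ} (x : Fin n → EuclideanSpace ℝ V) :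
    block (incompleteCov G x) A hA = blockGram ((↑) : A → V) x := by
  ext i j
  simp [block, incompleteCov, sampleCov, blockGram, gram, Matrix.mul_apply]

theorem ae_isUnit_block {K : Matrix V V ℝ} (hK : K.PosDef) {A : Finset V}
    (hA : G.IsClique (A : Set V)) {n : ℕ} (hn : A.card ≤ n) :
    ∀ᵐ x ∂(sampleLaw n K), IsUnit (block (incompleteCov G x) A hA) := by
  filter_upwards [ae_det_blockGram_ne_zero hK.inv (e := ((↑) : A → V)) Subtype.val_injective
    (by simpa using hn)] with x hx
  rw [block_incompleteCov, Matrix.isUnit_iff_isUnit_det]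
  exact hx.isUnit

theorem integral_zeroFill_inv_block {K : Matrix V V ℝ} (hK : K.PosDef) {A : Finset V}
    (hA : G.IsClique (A : Set V)) {n : ℕ} (hn : A.card + 2 ≤ n) (i j : V) :
    Integrable (fun x => zeroFill A
      (((n : ℝ) - A.card - 1) • (block (incompleteCov G x) A hA)⁻¹) i j) (sampleLaw n K) ∧
    ∫ x, zeroFill A (((n : ℝ) - A.card - 1) • (block (incompleteCov G x) A hA)⁻¹) i j
      ∂(sampleLaw n K) = localInv K⁻¹ A i j := by
  by_cases h : i ∈ A ∧ j ∈ A
  · have hI := integral_blockGram_inv hK.inv.posSemidef ((↑) : A → V) (n := n)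
      (by simpa using hn) ⟨i, h.1⟩ ⟨j, h.2⟩
    rw [Fintype.card_coe] at hI
    simp only [zeroFill, localInv, Matrix.of_apply, h, and_self, dite_true, block_incompleteCov,
      Matrix.smul_apply, smul_eq_mul, integral_const_mul]
    exact ⟨hI.1.const_mul _, hI.2⟩
  · simp [zeroFill, localInv, h]

/-- The coefficients correct the inverse Wishart means, so the expectation is the expression for `K`
in `IsPerfectCliqueOrder.eq_sum_localInv`. Each separator lies in a clique and inherits its size
bound. -/
theorem isUnbiased_closedForm {m : ℕ} {C : Fin (m + 1) → Finset V}
    (hC : IsPerfectCliqueOrder G C) {n : ℕ} (hn : ∀ k, (C k).card + 2 ≤ n) :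
    IsUnbiased G n (concentrationSet C) (closedForm hC n) := by
  have hns : ∀ k, (sep C k).card + 2 ≤ n := fun k =>
    (Nat.add_le_add_right (Finset.card_le_card Finset.inter_subset_right) 2).trans (hn k.succ)
  have happly : ∀ S i j, closedForm hC n S i j =
      ∑ k, zeroFill (C k)
        (((n : ℝ) - (C k).card - 1) • (block S (C k) (hC.isClique k))⁻¹) i j -
      ∑ k, zeroFill (sep C k)
        (((n : ℝ) - (sep C k).card - 1) • (block S (sep C k) (hC.isClique_sep k))⁻¹) i j :=
    fun S i j => by
      rw [closedForm, Matrix.sub_apply, Matrix.sum_apply, Matrix.sum_apply]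
  have hmeas : ∀ {A : Finset V} (hA : G.IsClique (A : Set V)) (c : ℝ) (i j : V),
      Measurable fun S : IncompleteMatrix G => zeroFill A (c • (block S A hA)⁻¹) i j :=
    fun {A} hA c i j => measurable_zeroFill_apply (fun k l =>
      (measurable_inv_apply_of_measurable (fun k l => measurable_pi_apply _) k l).const_smul c) i j
  refine ⟨fun i j => ?_, fun K hK i j => ?_, fun K hK i j => ?_⟩
  · simp only [happly]
    exact (Finset.measurable_sum _ fun k _ => hmeas _ _ i j).sub
      (Finset.measurable_sum _ fun k _ => hmeas _ _ i j)
  · simp only [happly]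
    exact (integrable_finsetSum _ fun k _ =>
        (integral_zeroFill_inv_block hK.1 (hC.isClique k) (hn k) i j).1).sub
      (integrable_finsetSum _ fun k _ =>
        (integral_zeroFill_inv_block hK.1 (hC.isClique_sep k) (hns k) i j).1)
  · have h1 := fun k => integral_zeroFill_inv_block hK.1 (hC.isClique k) (hn k) i j
    have h2 := fun k => integral_zeroFill_inv_block hK.1 (hC.isClique_sep k) (hns k) i j
    simp only [happly]
    rw [integral_sub (integrable_finsetSum _ fun k _ => (h1 k).1)
      (integrable_finsetSum _ fun k _ => (h2 k).1),
      integral_finsetSum _ fun k _ => (h1 k).1, integral_finsetSum _ fun k _ => (h2 k).1]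
    simp only [(h1 _).2, (h2 _).2]
    have h := congrFun (congrFun (hC.eq_sum_localInv hK) i) j
    rwa [Matrix.sub_apply, Matrix.sum_apply, Matrix.sum_apply] at h

/-- Two unbiased estimators which depend on the incomplete sample covariance only are almost surely
equal. -/
theorem IsUnbiased.ae_eq {m : ℕ} {C : Fin (m + 1) → Finset V} (hC : IsPerfectCliqueOrder G C)
    {n : ℕ} {T T' : IncompleteMatrix G → Matrix V V ℝ}
    (hT : IsUnbiased G n (concentrationSet C) T) (hT' : IsUnbiased G n (concentrationSet C) T')
    {K : Matrix V V ℝ} (hK : K ∈ concentrationSet C) :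
    ∀ᵐ x ∂(sampleLaw n K), T (incompleteCov G x) = T' (incompleteCov G x) := by
  have h : ∀ i j, ∀ᵐ x ∂(sampleLaw n K),
      T (incompleteCov G x) i j - T' (incompleteCov G x) i j = 0 := fun i j =>
    hC.ae_eq_zero_of_integral_eq_zero (g := fun S => T S i j - T' S i j)
      ((hT.measurable i j).sub (hT'.measurable i j))
      (fun K hK => (hT.integrable K hK i j).sub (hT'.integrable K hK i j))
      (fun K hK => by
        rw [integral_sub (hT.integrable K hK i j) (hT'.integrable K hK i j),
          hT.mean_eq K hK, hT'.mean_eq K hK, sub_self]) K hK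
  filter_upwards [ae_all_iff.2 fun i => ae_all_iff.2 (h i)] with x hx
  ext i j
  exact sub_eq_zero.1 (hx i j)

theorem variance_eq_of_ae_eq {n : ℕ} {T T' : IncompleteMatrix G → Matrix V V ℝ}
    {K : Matrix V V ℝ}
    (h : ∀ᵐ x ∂(sampleLaw n K), T (incompleteCov G x) = T' (incompleteCov G x)) :
    variance G n T K = variance G n T' K := by
  have hmean : ∀ i j, ∫ x, T (incompleteCov G x) i j ∂(sampleLaw n K) =
      ∫ x, T' (incompleteCov G x) i j ∂(sampleLaw n K) := fun i j =>
    integral_congr_ae (h.mono fun x hx => by simp only [hx])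
  unfold variance
  simp only [hmean]
  exact lintegral_congr_ae (h.mono fun x hx => by simp only [hx])

end Estimation

end GGM

/-- In a decomposable Gaussian graphical model, the closed form estimator exists with probability
one if `n ≥ maxₖ cₖ`; and it is the (almost surely unique) minimum variance unbiased estimator of
the concentration matrix, given the incomplete sample covariance, if `n ≥ maxₖ cₖ + 2`. -/
theorem theorem1 {V : Type*} [Fintype V] [DecidableEq V] (G : SimpleGraph V)
    (_hG : GGM.IsDecomposable G) {m : ℕ} (C : Fin (m + 1) → Finset V)
    (hC : GGM.IsPerfectCliqueOrder G C) (n : ℕ) :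
    ((∀ k, (C k).card ≤ n) →
      ∀ K ∈ GGM.concentrationSet C, ∀ᵐ x ∂(GGM.sampleLaw n K),
        GGM.ClosedFormExists hC (GGM.incompleteCov G x)) ∧
    ((∀ k, (C k).card + 2 ≤ n) →
      GGM.IsMVUE G n (GGM.concentrationSet C) (GGM.closedForm hC n) ∧
      ∀ T, GGM.IsMVUE G n (GGM.concentrationSet C) T →
        ∀ K ∈ GGM.concentrationSet C, ∀ᵐ x ∂(GGM.sampleLaw n K),
          T (GGM.incompleteCov G x) = GGM.closedForm hC n (GGM.incompleteCov G x)) := by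
  -- Every unbiased estimator is almost surely equal to the closed form, so minimality is an
  -- equality of variances, and uniqueness uses only that `T` is unbiased.
  refine ⟨fun hn K hK => ?_, fun hn => ⟨⟨GGM.isUnbiased_closedForm hC hn, fun T hT K hK =>
    (GGM.variance_eq_of_ae_eq (GGM.IsUnbiased.ae_eq hC (GGM.isUnbiased_closedForm hC hn) hT
      hK)).le⟩, fun T hT K hK =>
    GGM.IsUnbiased.ae_eq hC hT.unbiased (GGM.isUnbiased_closedForm hC hn) hK⟩⟩
  filter_upwards [ae_all_iff.2 fun k => GGM.ae_isUnit_block hK.1 (hC.isClique k) (hn k),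
    ae_all_iff.2 fun k => GGM.ae_isUnit_block hK.1 (hC.isClique_sep k)
      ((Finset.card_le_card Finset.inter_subset_right).trans (hn k.succ))] with x h1 h2
  exact ⟨h1, h2⟩
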